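/- Let $(\mathcal M,g)$ be a smooth spacetime of dimension $m+2$ with signature $(-,+,\dots,+)$, and let $\Delta\subset\mathcal M$ be a non-expanding horizon with base space $\hat\Delta$. That is, $\hat\Delta$ is a compact connected $m$-dimensional manifold; $\Delta$ is a null hypersurface, the image of an embedding $\hat\Delta\times\mathcal I\to\mathcal M$ with $\mathcal I$ an open interval; the null curves of $\Delta$ are the fibres $\{\hat x\}\times\mathcal I$ of the projection $\pi:\Delta\to\hat\Delta$; and $q^{AB}\mathcal L_\ell q_{AB}=0$ for every null vector field $\ell$ tangent to $\Delta$, where $q$ is the induced degenerate metric. (No field equation or energy condition is assumed.) Suppose $K$ is a Killing field of $(\mathcal M,g)$ tangent to $\Delta$, with restriction $k$ to $\Delta$. Suppose there is a smooth nowhere-vanishing null vector field $\ell$ tangent to $\Delta$ with $[\ell,k]=0$, and a smooth foliation of $\Delta$ whose leaves are images of smooth sections of $\pi$ and which is preserved by the (local) flow of $k$. Then there are a smooth function $v:\Delta\to\mathbb R$, whose level sets are exactly the leaves of this foliation and which together with local coordinates $x^A$ of $\hat\Delta$ (pulled back by $\pi$) gives coordinates $(x^A,v)$ on $\Delta$,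 real constants $a,b$, and a smooth vector field $\Phi=\Phi^A(x^B)\partial_A$ on $\hat\Delta$, such that $$k=a\,\partial_v+b\,\Phi^A(x^B)\,\partial_A\quad\text{on }\Delta ,$$ and, in the corresponding Bondi-like coordinates $(x^A,v,r)$ on any neighbourhood $\mathcal M'$ of $\Delta$ on which they are defined, $$K=a\,\partial_v+b\,\Phi^A(x^B)\,\partial_A\quad\text{on all of }\mathcal M' .$$ Here the Bondi-like coordinates are those obtained as follows. Let $n$ be the null vector field along $\Delta$ for which the pullback of $g(n,\cdot)$ to $\Delta$ is $-dv$; it is extended to an open neighbourhood $\mathcal M'$ of $\Delta$ by $\nabla_nn=0$, where every point of $\mathcal M'$ lies on an integral curve of $n$ in $\mathcal M'$ starting on $\Delta$. The field $\partial_v$ of $\Delta$ is extended to a field $\zeta$ on $\mathcal M'$ by $[n,\zeta]=0$. The function $r$ is defined by $n(r)=-1$, $r|_\Delta=0$, and $v$, $x^A$ are extended to $\mathcal M'$ by $\zeta(v)=1$, $n(v)=0$, $\zeta(x^A)=n(x^A)=0$; $\mathcal M'$ is such that the functions $(x^A,v,r)$ form a coordinate system on it. -/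

import Mathlib

open Set VectorField
open scoped Manifold ContDiff Topology

namespace Horizon

section General

variable {E : Type*} [NormedAddCommGroup E] [NormedSpace ℝ E]
  {H : Type*} [TopologicalSpace H] (I : ModelWithCorners ℝ E H)
  {N : Type*} [TopologicalSpace N] [ChartedSpace H N]

/-- The vector field `X` is smooth at the point `x`. -/
def SmoothAt [IsManifold I 1 N] (X : ∀ x : N, TangentSpace I x) (x : N) : Prop :=
  ContMDiffAt I I.tangent ∞ (fun y => (⟨y, X y⟩ : TangentBundle I N)) x

/-- The derivative `df_x(w)` of a real function `f` in the direction of a tangent vector `w`. -/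
noncomputable def dirDeriv (f : N → ℝ) (x : N) (w : TangentSpace I x) : ℝ :=
  mfderiv I 𝓘(ℝ, ℝ) f x w

/-- The Lie derivative of a field `q` of bilinear forms,
`(L_K q)(X, Y) = K(q(X, Y)) - q([K, X], Y) - q(X, [K, Y])`, at the point `x`. -/
noncomputable def lieForm (q : ∀ x : N, TangentSpace I x → TangentSpace I x → ℝ)
    (K X Y : ∀ x : N, TangentSpace I x) (x : N) : ℝ :=
  dirDeriv I (fun y => q y (X y) (Y y)) x (K x)
    - q x (mlieBracket I K X x) (Y x) - q x (X x) (mlieBracket I K Y x)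

/-- The number `g(∇_X Y, Z)` at `x`, where `∇` is the Levi-Civita connection of the symmetric
nondegenerate form `g`, as given by the Koszul formula. -/
noncomputable def koszul (g : ∀ x : N, TangentSpace I x → TangentSpace I x → ℝ)
    (X Y Z : ∀ x : N, TangentSpace I x) (x : N) : ℝ :=
  (1 / 2 : ℝ) *
    (dirDeriv I (fun y => g y (Y y) (Z y)) x (X x)
      + dirDeriv I (fun y => g y (Z y) (X y)) x (Y x)
      - dirDeriv I (fun y => g y (X y) (Y y)) x (Z x)
      + g x (mlieBracket I X Y x) (Z x)
      - g x (mlieBracket I Y Z x) (X x)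
      + g x (mlieBracket I Z X x) (Y x))

end General

section Spacetime

variable {m : ℕ} {M : Type*} [TopologicalSpace M]
  [ChartedSpace (EuclideanSpace ℝ (Fin (m + 2))) M] [IsManifold (𝓡 (m + 2)) ∞ M]

variable (m M) in
/-- A smooth metric tensor of signature `(-, +, ..., +)` on a manifold of dimension `m + 2`. -/
structure LorentzMetric where
  /-- The scalar product on the tangent space at `x`. -/
  val (x : M) : TangentSpace (𝓡 (m + 2)) x →L[ℝ] TangentSpace (𝓡 (m + 2)) x →L[ℝ] ℝ
  symm (x : M) (v w : TangentSpace (𝓡 (m + 2)) x) : val x v w = val x w v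
  contMDiff : ContMDiff (𝓡 (m + 2))
    ((𝓡 (m + 2)).prod 𝓘(ℝ, EuclideanSpace ℝ (Fin (m + 2)) →L[ℝ]
      EuclideanSpace ℝ (Fin (m + 2)) →L[ℝ] ℝ)) ∞
    (fun x => Bundle.TotalSpace.mk' (EuclideanSpace ℝ (Fin (m + 2)) →L[ℝ]
      EuclideanSpace ℝ (Fin (m + 2)) →L[ℝ] ℝ)
      (E := fun x : M => TangentSpace (𝓡 (m + 2)) x →L[ℝ] TangentSpace (𝓡 (m + 2)) x →L[ℝ] ℝ)
      x (val x))
  signature (x : M) : ∃ e : Module.Basis (Fin (m + 2)) ℝ (TangentSpace (𝓡 (m + 2)) x),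
    ∀ i k, val x (e i) (e k) = if i = k then (if i = 0 then -1 else 1) else 0

/-- `g` as a field of real-valued functions of two tangent vectors. -/
noncomputable def LorentzMetric.form (g : LorentzMetric m M) (x : M)
    (v w : TangentSpace (𝓡 (m + 2)) x) : ℝ := g.val x v w

/-- `K` is a (smooth) Killing field: `L_K g = 0`. -/
def IsKilling (g : LorentzMetric m M) (K : ∀ x : M, TangentSpace (𝓡 (m + 2)) x) : Prop :=
  (∀ x, SmoothAt (𝓡 (m + 2)) K x) ∧
  ∀ (x : M) (X Y : ∀ x : M, TangentSpace (𝓡 (m + 2)) x),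
    SmoothAt (𝓡 (m + 2)) X x → SmoothAt (𝓡 (m + 2)) Y x →
      lieForm (𝓡 (m + 2)) g.form K X Y x = 0

variable {B : Type*} [TopologicalSpace B] [ChartedSpace (EuclideanSpace ℝ (Fin m)) B]
  [IsManifold (𝓡 m) ∞ B]

variable (m) in
/-- The model of the horizon `B × ℝ`. -/
noncomputable abbrev HModel :
    ModelWithCorners ℝ (EuclideanSpace ℝ (Fin m) × ℝ) (ModelProd (EuclideanSpace ℝ (Fin m)) ℝ) :=
  (𝓡 m).prod 𝓘(ℝ, ℝ)

/-- The differential of `j : B × ℝ → M`. -/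
noncomputable def push (j : B × ℝ → M) (p : B × ℝ) (w : TangentSpace (HModel m) p) :
    TangentSpace (𝓡 (m + 2)) (j p) :=
  mfderiv (HModel m) (𝓡 (m + 2)) j p w

/-- The (degenerate) metric `q = j^* g` induced on `B × ℝ`. -/
noncomputable def induced (g : LorentzMetric m M) (j : B × ℝ → M) (p : B × ℝ)
    (w w' : TangentSpace (HModel m) p) : ℝ :=
  g.form (j p) (push j p w) (push j p w')

/-- The differential at `p` of the projection `B × ℝ → B`. -/
noncomputable def baseComp (p : B × ℝ) (w : TangentSpace (HModel m) p) :
    TangentSpace (𝓡 m) p.1 :=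
  mfderiv (HModel m) (𝓡 m) (Prod.fst : B × ℝ → B) p w

/-- The vector field `ℓ` on the horizon is null. -/
def IsNullField (g : LorentzMetric m M) (j : B × ℝ → M)
    (ℓ : ∀ p : B × ℝ, TangentSpace (HModel m) p) : Prop :=
  ∀ p, induced g j p (ℓ p) (ℓ p) = 0

/-- `j : B × ℝ → M` exhibits its image as a non-expanding horizon of `(M, g)` with base space
`B` (every open interval is diffeomorphic to `ℝ`, so the second factor is taken to be `ℝ`). -/
structure IsNonExpandingHorizon (g : LorentzMetric m M) (j : B × ℝ → M) : Prop where
  embedding : Manifold.IsSmoothEmbedding (HModel m) (𝓡 (m + 2)) ∞ j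
  /-- the hypersurface is null: the induced metric is degenerate -/
  null : ∀ p, ∃ w : TangentSpace (HModel m) p, w ≠ 0 ∧ ∀ w', induced g j p w w' = 0
  /-- the null curves of the hypersurface are the fibres `{x} × ℝ` -/
  generators : ∀ p (w : TangentSpace (HModel m) p), baseComp p w = 0 → induced g j p w w = 0
  /-- the trace of `L_ℓ q` over `T(B × ℝ) / L` vanishes for every null `ℓ`; the fields `e i` are
  `q`-orthonormal at `p`, so that they represent a `q`-orthonormal basis of the quotient -/
  expansion : ∀ ℓ : (∀ p : B × ℝ, TangentSpace (HModel m) p),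
    (∀ p, SmoothAt (HModel m) ℓ p) → IsNullField g j ℓ →
    ∀ (p : B × ℝ) (e : Fin m → ∀ p : B × ℝ, TangentSpace (HModel m) p),
      (∀ i, SmoothAt (HModel m) (e i) p) →
      (∀ i k, induced g j p (e i p) (e k p) = if i = k then 1 else 0) →
      ∑ i, lieForm (HModel m) (induced g j) ℓ (e i) (e i) p = 0

/-- `K` is tangent to the horizon and `k` is its restriction, a section of `T(B × ℝ)`. -/
def IsRestriction (j : B × ℝ → M) (K : ∀ x : M, TangentSpace (𝓡 (m + 2)) x)
    (k : ∀ p : B × ℝ, TangentSpace (HModel m) p) : Prop :=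
  (∀ p, SmoothAt (HModel m) k p) ∧ ∀ p, push j p (k p) = K (j p)

variable (m) in
/-- The classes of `leaf` are the leaves of a smooth codimension-one foliation of `B × ℝ`, and
each of them is the image of a smooth section of the projection `B × ℝ → B`. (A fibre meets such
a leaf only once, so a leaf meets a small foliated chart `U` in a single plaque `u = const`.) -/
structure IsFoliationBySections (leaf : Setoid (B × ℝ)) : Prop where
  section_leaf : ∀ p, ∃ σ : B → B × ℝ, ContMDiff (𝓡 m) (HModel m) ∞ σ ∧
    (∀ x, (σ x).1 = x) ∧ {q | leaf p q} = range σ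
  foliated_chart : ∀ p : B × ℝ, ∃ (U : Set (B × ℝ)) (u : B × ℝ → ℝ), IsOpen U ∧ p ∈ U ∧
    ContMDiffOn (HModel m) 𝓘(ℝ, ℝ) ∞ u U ∧
    (∀ q ∈ U, ∃ w : TangentSpace (HModel m) q, dirDeriv (HModel m) u q w ≠ 0) ∧
    ∀ q ∈ U, ∀ q' ∈ U, leaf q q' ↔ u q = u q'

/-- The (local) flow of `k` maps leaves into leaves. -/
def PreservedByFlow (leaf : Setoid (B × ℝ)) (k : ∀ p : B × ℝ, TangentSpace (HModel m) p) :
    Prop :=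
  ∀ (γ γ' : ℝ → B × ℝ) (t : ℝ), IsMIntegralCurveOn γ k (uIcc 0 t) →
    IsMIntegralCurveOn γ' k (uIcc 0 t) → leaf (γ 0) (γ' 0) → leaf (γ t) (γ' t)

variable (m) in
/-- Together with coordinates `x^A` of `B`, constant along the fibres, the function `v` gives
coordinates `(x^A, v)` on the horizon. -/
structure IsHorizonCoordinate (v : B × ℝ → ℝ) : Prop where
  smooth : ContMDiff (HModel m) 𝓘(ℝ, ℝ) ∞ v
  injective : Function.Injective (fun p : B × ℝ => (p.1, v p))
  localDiffeo : IsLocalDiffeomorph (HModel m) (HModel m) ∞ (fun p : B × ℝ => (p.1, v p))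

/-- The Bondi-like extension of the coordinates `(x^A, v)` of the horizon to a neighbourhood `U`
of it. Here `n` is the transversal null geodesic field, `ζ` the extension of `ℓ = ∂_v`, `r` the
affine radial coordinate, `V` the extension of `v`, and `X : U → B` the extension of the projection
onto `B` (so that the coordinates `x^A` on `U` are those of `X y` in the charts of `B`). -/
structure IsBondiLike (g : LorentzMetric m M) (j : B × ℝ → M) (v : B × ℝ → ℝ) (U : Set M)
    (n ζ : ∀ x : M, TangentSpace (𝓡 (m + 2)) x) (X : M → B) (V r : M → ℝ) : Prop where
  isOpen : IsOpen U
  range_subset : range j ⊆ U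
  n_smooth : ∀ y ∈ U, SmoothAt (𝓡 (m + 2)) n y
  n_null : ∀ y ∈ U, g.form y (n y) (n y) = 0
  /-- the pullback of `g(n, ·)` to the horizon is `-dv` -/
  n_horizon : ∀ p w, g.form (j p) (n (j p)) (push j p w) = - dirDeriv (HModel m) v p w
  /-- `∇_n n = 0` -/
  n_geodesic : ∀ y ∈ U, ∀ Z : (∀ x : M, TangentSpace (𝓡 (m + 2)) x),
    SmoothAt (𝓡 (m + 2)) Z y → koszul (𝓡 (m + 2)) g.form n n Z y = 0
  /-- every point of `U` lies on an integral curve of `n` inside `U` that starts on the horizon -/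
  n_foliates : ∀ y ∈ U, ∃ (p : B × ℝ) (s : ℝ) (γ : ℝ → M),
    IsMIntegralCurveOn γ n (uIcc 0 s) ∧ (∀ t ∈ uIcc 0 s, γ t ∈ U) ∧ γ 0 = j p ∧ γ s = y
  ζ_smooth : ∀ y ∈ U, SmoothAt (𝓡 (m + 2)) ζ y
  /-- on the horizon, `ζ = ℓ = ∂_v` -/
  ζ_horizon : ∀ p (w : TangentSpace (HModel m) p), baseComp p w = 0 →
    dirDeriv (HModel m) v p w = 1 → ζ (j p) = push j p w
  ζ_dragged : ∀ y ∈ U, mlieBracket (𝓡 (m + 2)) n ζ y = 0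
  r_smooth : ContMDiffOn (𝓡 (m + 2)) 𝓘(ℝ, ℝ) ∞ r U
  r_horizon : ∀ p, r (j p) = 0
  r_n : ∀ y ∈ U, dirDeriv (𝓡 (m + 2)) r y (n y) = -1
  V_smooth : ContMDiffOn (𝓡 (m + 2)) 𝓘(ℝ, ℝ) ∞ V U
  V_horizon : ∀ p, V (j p) = v p
  V_n : ∀ y ∈ U, dirDeriv (𝓡 (m + 2)) V y (n y) = 0
  V_ζ : ∀ y ∈ U, dirDeriv (𝓡 (m + 2)) V y (ζ y) = 1
  X_smooth : ContMDiffOn (𝓡 (m + 2)) (𝓡 m) ∞ X U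
  X_horizon : ∀ p, X (j p) = p.1
  X_n : ∀ y ∈ U, mfderiv (𝓡 (m + 2)) (𝓡 m) X y (n y) = 0
  X_ζ : ∀ y ∈ U, mfderiv (𝓡 (m + 2)) (𝓡 m) X y (ζ y) = 0
  /-- `(x^A, v, r)` is a coordinate system on `U` -/
  injOn : InjOn (fun y => (X y, V y, r y)) U
  bijective : ∀ y ∈ U, Function.Bijective (fun w : TangentSpace (𝓡 (m + 2)) y =>
    (mfderiv (𝓡 (m + 2)) (𝓡 m) X y w, dirDeriv (𝓡 (m + 2)) V y w, dirDeriv (𝓡 (m + 2)) r y w))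

end Spacetime

end Horizon

/-! On the horizon, null vectors are vertical, that is, tangent to the fibres, so $[\ell,k]=0$ makes
$k$ project to a field $\Phi$ on the base (`baseComp_eq_of_commute`). For the coordinate $v$, fix a
fibre and let $u(p)$ be the height at which the leaf through $p$ meets it. This $u$ is smooth, its
level sets are the leaves, and $(\pi,u)$ is a diffeomorphism of $B\times\mathbb R$. Invariance of
the foliation gives $k(u)=f(u)$ for a function $f$ of one variable.

The crux is that $f$ vanishes identically or nowhere (`eq_zero_of_eq_zero`). Since $[\ell,k]=0$,
$k(\ell u)=\ell(ku)=f'(u)\,\ell u$, so $f(u)/\ell u$ is constant along $k$. Hence $(f(u)/\ell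
u)^2e^{-Nu}$ has $k$-derivative $-Nf(u)$ times itself and no interior maximum where $f(u)\ne 0$. If
$f(c)=0\ne f(d)$, look at this function on the slab between $u=c$ and $u=d$, which is compact
because $B$ is: it vanishes at $u=c$, and a suitable $N$ makes it small at $u=d$ compared with some
point in between, which forces such a maximum. Given the dichotomy, take $v=u$ with $a=0$, or
$v=\int du/f$ with $a=1$.

Off the horizon, everything is propagated along $n$. First, $g(n,\cdot)=-dV$ on all of $U$
(`form_n`): it holds on the horizon, and on coordinate fields both sides are constant along the
geodesic field $n$. The Killing equation then reads $g([K,n],Z)=-Z(KV)$. As $g([K,n],n)=0$, $KV$ is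
constant along $n$, hence equal to $a$ everywhere; nondegeneracy gives $[K,n]=0$
(`mlieBracket_killing_n`). Therefore $Kr$ and the components $Kx^A$ are constant along $n$ too and
keep their horizon values. -/

namespace Horizon

/-! ### Directional derivatives of vector-valued functions. -/

section Calculus

variable {E : Type*} [NormedAddCommGroup E] [NormedSpace ℝ E]
  {H : Type*} [TopologicalSpace H] {I : ModelWithCorners ℝ E H}
  {N : Type*} [TopologicalSpace N] [ChartedSpace H N]
  {E' : Type*} [NormedAddCommGroup E'] [NormedSpace ℝ E']
  {H' : Type*} [TopologicalSpace H'] {I' : ModelWithCorners ℝ E' H'}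
  {N' : Type*} [TopologicalSpace N'] [ChartedSpace H' N']
  {F : Type*} [NormedAddCommGroup F] [NormedSpace ℝ F]

variable (I) in
/-- The derivative of a vector-valued function in the direction of a tangent vector. -/
noncomputable def vderiv (f : N → F) (x : N) (w : TangentSpace I x) : F :=
  mfderiv I 𝓘(ℝ, F) f x w

lemma dirDeriv_eq_vderiv (f : N → ℝ) (x : N) (w : TangentSpace I x) :
    dirDeriv I f x w = vderiv I f x w := rfl

lemma vderiv_congr {f f' : N → F} {x : N} (h : f =ᶠ[𝓝 x] f') (w : TangentSpace I x) :
    vderiv I f x w = vderiv I f' x w := by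
  unfold vderiv
  rw [Filter.EventuallyEq.mfderiv_eq h]
  rfl

lemma vderiv_const (c : F) (x : N) (w : TangentSpace I x) :
    vderiv I (fun _ : N => c) x w = 0 := by
  unfold vderiv
  rw [mfderiv_const]
  rfl

lemma vderiv_add (f : N → F) (x : N) (w w' : TangentSpace I x) :
    vderiv I f x (w + w') = vderiv I f x w + vderiv I f x w' :=
  map_add (mfderiv I 𝓘(ℝ, F) f x) w w'

lemma vderiv_sub (f : N → F) (x : N) (w w' : TangentSpace I x) :
    vderiv I f x (w - w') = vderiv I f x w - vderiv I f x w' :=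
  map_sub (mfderiv I 𝓘(ℝ, F) f x) w w'

lemma vderiv_smul (f : N → F) (x : N) (c : ℝ) (w : TangentSpace I x) :
    vderiv I f x (c • w) = c • vderiv I f x w :=
  map_smul (mfderiv I 𝓘(ℝ, F) f x) c w

lemma vderiv_zero (f : N → F) (x : N) :
    vderiv I f x (0 : TangentSpace I x) = 0 :=
  map_zero (mfderiv I 𝓘(ℝ, F) f x)

/-- Chain rule. -/
lemma vderiv_comp {f : N' → F} {h : N → N'} {x : N}
    (hf : MDifferentiableAt I' 𝓘(ℝ, F) f (h x)) (hh : MDifferentiableAt I I' h x)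
    (w : TangentSpace I x) :
    vderiv I (fun y => f (h y)) x w = vderiv I' f (h x) (mfderiv I I' h x w) := by
  have := mfderiv_comp x hf hh
  unfold vderiv
  change mfderiv I 𝓘(ℝ, F) (f ∘ h) x w = _
  rw [this]
  rfl

lemma vderiv_prodMk {F' : Type*} [NormedAddCommGroup F'] [NormedSpace ℝ F'] {f : N → F}
    {f' : N → F'} {x : N} (hf : MDifferentiableAt I 𝓘(ℝ, F) f x)
    (hf' : MDifferentiableAt I 𝓘(ℝ, F') f' x) (w : TangentSpace I x) :
    vderiv I (fun y => (f y, f' y)) x w = (vderiv I f x w, vderiv I f' x w) := by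
  let L : E →L[ℝ] F := mfderiv I 𝓘(ℝ, F) f x
  let L' : E →L[ℝ] F' := mfderiv I 𝓘(ℝ, F') f' x
  have h : HasMFDerivAt I 𝓘(ℝ, F × F') (fun y => (f y, f' y)) x (L.prod L') :=
    ⟨hf.hasMFDerivAt.1.prodMk hf'.hasMFDerivAt.1,
      hf.hasMFDerivAt.2.prodMk hf'.hasMFDerivAt.2⟩
  unfold vderiv
  rw [h.mfderiv]
  rfl

variable [IsManifold I 1 N] [IsManifold I' 1 N']

lemma SmoothAt.contMDiffAt_mfderiv {f : N → N'} {X : ∀ x : N, TangentSpace I x} {x : N}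
    (hf : ContMDiffAt I I' ∞ f x) (hX : SmoothAt I X x) :
    ContMDiffAt I I'.tangent ∞
      (fun y => (⟨f y, mfderiv I I' f y (X y)⟩ : TangentBundle I' N')) x :=
  ContMDiffAt.clm_apply_of_inCoordinates (b₁ := id) (b₂ := f)
    (hf.mfderiv_const le_rfl) hX hf

lemma SmoothAt.contMDiffAt_vderiv {f : N → F} {X : ∀ x : N, TangentSpace I x} {x : N}
    (hf : ContMDiffAt I 𝓘(ℝ, F) ∞ f x) (hX : SmoothAt I X x) :
    ContMDiffAt I 𝓘(ℝ, F) ∞ (fun y => vderiv I f y (X y)) x := 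
  ((contMDiff_snd_tangentBundle_modelSpace F 𝓘(ℝ, F)).contMDiffAt).comp x
    (SmoothAt.contMDiffAt_mfderiv hf hX)

lemma SmoothAt.mdifferentiableAt {X : ∀ x : N, TangentSpace I x} {x : N} (hX : SmoothAt I X x) :
    MDifferentiableAt I I.tangent (fun y => (⟨y, X y⟩ : TangentBundle I N)) x :=
  ContMDiffAt.mdifferentiableAt hX (by simp)

end Calculus
-- The Lie bracket as a commutator of derivations.
section Commutator
variable {E : Type*} [NormedAddCommGroup E] [NormedSpace ℝ E]
  {H : Type*} [TopologicalSpace H] {I : ModelWithCorners ℝ E H} [I.Boundaryless]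
  {N : Type*} [TopologicalSpace N] [ChartedSpace H N] [IsManifold I ∞ N]
  {F : Type*} [NormedAddCommGroup F] [NormedSpace ℝ F]

/-- Chain rule for the inverse chart. It holds at every point of the chart target, so the chart
expression of $Xf$ can be differentiated again. -/
lemma vderiv_eq_fderiv_chart {f : N → F} {x₀ : N} {z : E} (hz : z ∈ (extChartAt I x₀).target)
    (hf : MDifferentiableAt I 𝓘(ℝ, F) f ((extChartAt I x₀).symm z))
    (X : ∀ x : N, TangentSpace I x) :
    vderiv I f ((extChartAt I x₀).symm z) (X ((extChartAt I x₀).symm z)) =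
      fderiv ℝ (f ∘ (extChartAt I x₀).symm) z
        (mpullbackWithin 𝓘(ℝ, E) I (extChartAt I x₀).symm X (range I) z) := by
  have : IsManifold I 1 N := IsManifold.of_le (n := ∞) (by simp)
  have hinv := isInvertible_mfderivWithin_extChartAt_symm (I := I) hz
  have hd : MDifferentiableAt 𝓘(ℝ, E) I (extChartAt I x₀).symm z := by
    have := (contMDiffOn_extChartAt_symm (I := I) (n := 1) x₀).contMDiffAt
      ((isOpen_extChartAt_target x₀).mem_nhds hz)
    exact this.mdifferentiableAt (by simp)
  have h2 := mfderiv_comp z hf hd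
  rw [mpullbackWithin_apply, ← mfderiv_eq_fderiv, h2]
  obtain ⟨A, hA⟩ := hinv
  have hA' : mfderiv 𝓘(ℝ, E) I (extChartAt I x₀).symm z = A := by
    rw [hA, I.range_eq_univ, mfderivWithin_univ]
  rw [← hA, hA', ContinuousLinearMap.inverse_equiv]
  change _ = mfderiv I 𝓘(ℝ, F) f _ (A (A.symm _))
  rw [A.apply_symm_apply]
  rfl

variable [CompleteSpace E]

/-- The bracket of vector fields is the commutator of the derivations that they define. -/
lemma vderiv_mlieBracket {f : N → F} {X Y : ∀ x : N, TangentSpace I x} {x : N}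
    (hf : ContMDiffAt I 𝓘(ℝ, F) ∞ f x) (hX : SmoothAt I X x) (hY : SmoothAt I Y x) :
    vderiv I f x (mlieBracket I X Y x) =
      vderiv I (fun y => vderiv I f y (Y y)) x (X x)
        - vderiv I (fun y => vderiv I f y (X y)) x (Y x) := by
  have : IsManifold I 2 N := IsManifold.of_le (n := ∞) (by norm_cast)
  set φ := extChartAt I x with hφ
  have hz : φ x ∈ φ.target := mem_extChartAt_target x
  have hx : φ.symm (φ x) = x := extChartAt_to_inv x
  have hev : ∀ᶠ y in 𝓝 x, MDifferentiableAt I 𝓘(ℝ, F) f y := by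
    have h1 : ContMDiffAt I 𝓘(ℝ, F) 1 f x := hf.of_le (by simp)
    filter_upwards [(contMDiffAt_iff_contMDiffAt_nhds (by simp)).1 h1] with y hy
    exact hy.mdifferentiableAt (by simp)
  have hcont : Filter.Tendsto φ.symm (𝓝 (φ x)) (𝓝 x) := by
    have := continuousAt_extChartAt_symm (I := I) x
    rwa [ContinuousAt, hx] at this
  have hdef : ∀ᶠ z in 𝓝 (φ x), z ∈ φ.target ∧ MDifferentiableAt I 𝓘(ℝ, F) f (φ.symm z) :=
    Filter.Eventually.and ((isOpen_extChartAt_target x).mem_nhds hz) (hcont.eventually hev)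
  let rep : (∀ x : N, TangentSpace I x) → E → E := fun Z z =>
    mpullbackWithin 𝓘(ℝ, E) I φ.symm Z (range I) z
  have key : ∀ (g : N → F) (Z : ∀ x : N, TangentSpace I x), MDifferentiableAt I 𝓘(ℝ, F) g x →
      vderiv I g x (Z x) = fderiv ℝ (g ∘ φ.symm) (φ x)
        (rep Z (φ x)) := by
    intro g Z hg
    have := vderiv_eq_fderiv_chart (f := g) hz (by rwa [hx]) Z
    rwa [hx] at this
  have hvd : ∀ Z : ∀ x : N, TangentSpace I x, ((fun y => vderiv I f y (Z y)) ∘ φ.symm)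
      =ᶠ[𝓝 (φ x)] fun z => fderiv ℝ (f ∘ φ.symm) z
        (rep Z z) := by
    intro Z
    filter_upwards [hdef] with z hz'
    exact vderiv_eq_fderiv_chart hz'.1 hz'.2 Z
  have hdiff : ∀ Z : ∀ x : N, TangentSpace I x, SmoothAt I Z x →
      DifferentiableAt ℝ (rep Z) (φ x) := by
    intro Z hZ
    have := MDifferentiableWithinAt.differentiableWithinAt_mpullbackWithin_vectorField
      (hZ.mdifferentiableAt.mdifferentiableWithinAt (s := univ))
    rw [preimage_univ, univ_inter] at this
    exact this.differentiableAt (by rw [I.range_eq_univ]; exact Filter.univ_mem)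
  have hfc : ContDiffAt ℝ 2 (f ∘ φ.symm) (φ x) := by
    have h1 : ContMDiffAt I 𝓘(ℝ, F) 2 f (φ.symm (φ x)) := by
      rw [hx]; exact hf.of_le (by norm_cast)
    have h2 : ContMDiffAt 𝓘(ℝ, E) I 2 φ.symm (φ x) :=
      (contMDiffOn_extChartAt_symm (I := I) (n := 2) x).contMDiffAt
      ((isOpen_extChartAt_target x).mem_nhds hz)
    exact (h1.comp (φ x) h2).contDiffAt
  have hf2 : DifferentiableAt ℝ (fderiv ℝ (f ∘ φ.symm)) (φ x) :=
    (hfc.fderiv_right (m := 1) (by norm_num)).differentiableAt (by simp)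
  have hsym : IsSymmSndFDerivAt ℝ (f ∘ φ.symm) (φ x) := hfc.isSymmSndFDerivAt (by simp)
  -- The manifold bracket is the bracket of the chart representatives, carried back by the inverse
  -- of the differential of the chart; this evaluates `f` on such vectors.
  have hbr : ∀ u : E, vderiv I f x ((mfderiv I 𝓘(ℝ, E) φ x).inverse u) =
      fderiv ℝ (f ∘ φ.symm) (φ x) u := by
    intro u
    have hc : f =ᶠ[𝓝 x] fun y => (f ∘ φ.symm) (φ y) := by
      filter_upwards [extChartAt_source_mem_nhds (I := I) x] with y hy
      exact congrArg f ((extChartAt I x).left_inv hy).symm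
    rw [vderiv_congr hc, vderiv_comp (I' := 𝓘(ℝ, E))
      (hfc.differentiableAt (by simp)).mdifferentiableAt (mdifferentiableAt_extChartAt
        (mem_chart_source H x))]
    obtain ⟨A, hA⟩ := isInvertible_mfderiv_extChartAt (I := I) (mem_extChartAt_source (I := I) x)
    rw [← hA, ContinuousLinearMap.inverse_equiv]
    unfold vderiv
    rw [mfderiv_eq_fderiv]
    change _ = (fderiv ℝ (f ∘ φ.symm) (φ x)) u
    exact congrArg (fderiv ℝ (f ∘ φ.symm) (φ x)) (A.apply_symm_apply u)
  have hXs := (SmoothAt.contMDiffAt_vderiv hf hX).mdifferentiableAt (by simp)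
  have hYs := (SmoothAt.contMDiffAt_vderiv hf hY).mdifferentiableAt (by simp)
  rw [key _ X hYs, key _ Y hXs, (hvd X).fderiv_eq, (hvd Y).fderiv_eq]
  rw [fderiv_clm_apply hf2 (hdiff X hX), fderiv_clm_apply hf2 (hdiff Y hY)]
  have hb : mlieBracket I X Y x =
      (mfderiv I 𝓘(ℝ, E) φ x).inverse (lieBracketWithin ℝ (E := E) (rep X) (rep Y)
        (φ.symm ⁻¹' univ ∩ range I) (φ x) : E) := rfl
  rw [hb]
  refine (hbr _).trans ?_
  rw [preimage_univ, univ_inter, I.range_eq_univ, lieBracketWithin_univ]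
  -- The second-derivative terms of the commutator cancel by symmetry; the first-order terms that
  -- remain form the bracket in the chart.
  have := hsym.eq (rep X (φ x)) (rep Y (φ x))
  simp only [lieBracket, map_sub, add_apply, ContinuousLinearMap.comp_apply,
    ContinuousLinearMap.flip_apply, this]
  abel

end Commutator

/-! ### The inverse function theorem on manifolds. -/

section InverseFunction

variable {E : Type*} [NormedAddCommGroup E] [NormedSpace ℝ E]
  {H : Type*} [TopologicalSpace H] {I : ModelWithCorners ℝ E H}
  {N : Type*} [TopologicalSpace N] [ChartedSpace H N]
  {E' : Type*} [NormedAddCommGroup E'] [NormedSpace ℝ E']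
  {H' : Type*} [TopologicalSpace H'] {I' : ModelWithCorners ℝ E' H'}
  {N' : Type*} [TopologicalSpace N'] [ChartedSpace H' N']

lemma isLocalDiffeomorphAt_extChartAt [I.Boundaryless] [IsManifold I ∞ N] (x : N) :
    IsLocalDiffeomorphAt I 𝓘(ℝ, E) ∞ (extChartAt I x) x :=
  ⟨{ toPartialEquiv := extChartAt I x
     open_source := isOpen_extChartAt_source x
     open_target := isOpen_extChartAt_target x
     contMDiffOn_toFun := (contMDiffOn_extChartAt (I := I) (n := ∞) (x := x)).mono
       (by rw [extChartAt_source])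
     contMDiffOn_invFun := contMDiffOn_extChartAt_symm x },
   mem_extChartAt_source x, fun _ _ => rfl⟩

lemma isLocalDiffeomorphAt_extChartAt_symm [I.Boundaryless] [IsManifold I ∞ N] (x : N) {z : E}
    (hz : z ∈ (extChartAt I x).target) :
    IsLocalDiffeomorphAt 𝓘(ℝ, E) I ∞ (extChartAt I x).symm z :=
  ⟨{ toPartialEquiv := (extChartAt I x).symm
     open_source := isOpen_extChartAt_target x
     open_target := isOpen_extChartAt_source x
     contMDiffOn_invFun := (contMDiffOn_extChartAt (I := I) (n := ∞) (x := x)).mono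
       (by rw [← extChartAt_source I]; rfl)
     contMDiffOn_toFun := contMDiffOn_extChartAt_symm x },
   hz, fun _ _ => rfl⟩

lemma IsLocalDiffeomorphAt.congr {f f' : N → N'} {x : N}
    (hf : IsLocalDiffeomorphAt I I' ∞ f x) (h : f' =ᶠ[𝓝 x] f) :
    IsLocalDiffeomorphAt I I' ∞ f' x := by
  obtain ⟨Φ, hx, hΦ⟩ := hf
  obtain ⟨s, hs, hso, hxs⟩ := eventually_nhds_iff.1 h
  refine ⟨{ toPartialEquiv := Φ.toPartialEquiv.restr s
            open_source := ?_, open_target := ?_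
            contMDiffOn_toFun := Φ.contMDiffOn_toFun.mono fun y hy => hy.1
            contMDiffOn_invFun := Φ.contMDiffOn_invFun.mono fun y hy => hy.1 },
          ⟨hx, hxs⟩, ?_⟩
  · exact Φ.open_source.inter hso
  · exact Φ.contMDiffOn_invFun.continuousOn.isOpen_inter_preimage Φ.open_target hso
  · intro y hy
    exact (hs y hy.2).trans (hΦ hy.1)

lemma isLocalDiffeomorphAt_of_fderiv [CompleteSpace E] {f : E → E'} {s : Set E} {a : E}
    (hs : s ∈ 𝓝 a) (hf : ContDiffOn ℝ ∞ f s) {A : E ≃L[ℝ] E'} (hA : fderiv ℝ f a = A) :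
    IsLocalDiffeomorphAt 𝓘(ℝ, E) 𝓘(ℝ, E') ∞ f a := by
  have hfa : ContDiffAt ℝ ∞ f a := hf.contDiffAt hs
  have hd : HasFDerivAt f (A : E →L[ℝ] E') a := by
    rw [← hA]; exact (hfa.differentiableAt (by simp)).hasFDerivAt
  -- Invertible maps form an open set, so the differential stays invertible near `a`; restricted
  -- there, the local inverse is smooth on a whole open set and not only at one point.
  have hev : ∀ᶠ z in 𝓝 a, z ∈ interior s ∧
      fderiv ℝ f z ∈ range ((↑) : (E ≃L[ℝ] E') → E →L[ℝ] E') := by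
    have h1 : ∀ᶠ z in 𝓝 a, z ∈ interior s := interior_mem_nhds.2 hs
    refine h1.and ?_
    refine (hfa.continuousAt_fderiv (by simp)).eventually_mem ?_
    rw [hA]
    exact ContinuousLinearEquiv.nhds A
  obtain ⟨t, ht, hto, hat⟩ := eventually_nhds_iff.1 hev
  set e := hfa.toOpenPartialHomeomorph f hd (by simp) with he
  have hcd : ∀ z ∈ t, ContDiffAt ℝ ∞ f z := fun z hz =>
    hf.contDiffAt (mem_interior_iff_mem_nhds.1 (ht z hz).1)
  refine ⟨{ toPartialEquiv := e.toPartialEquiv.restr t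
            open_source := e.open_source.inter hto
            open_target := e.continuousOn_symm.isOpen_inter_preimage e.open_target hto
            contMDiffOn_toFun := fun z hz => ((hcd z hz.2).contMDiffAt).contMDiffWithinAt
            contMDiffOn_invFun := ?_ },
          ⟨hfa.mem_toOpenPartialHomeomorph_source hd (by simp), hat⟩, fun _ _ => rfl⟩
  intro w hw
  obtain ⟨hw1, hw2⟩ := hw
  obtain ⟨A', hA'⟩ := (ht _ hw2).2
  refine (e.contDiffAt_symm (f₀' := A') hw1 ?_ (hcd _ hw2)).contMDiffAt.contMDiffWithinAt
  rw [hA']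
  exact ((hcd _ hw2).differentiableAt (by simp)).hasFDerivAt

/-- Inverse function theorem. -/
lemma isLocalDiffeomorphAt_of_mfderiv [I.Boundaryless] [I'.Boundaryless] [CompleteSpace E]
    [CompleteSpace E'] [IsManifold I ∞ N] [IsManifold I' ∞ N'] {f : N → N'} {s : Set N} {x : N}
    (hs : s ∈ 𝓝 x) (hf : ContMDiffOn I I' ∞ f s)
    (hb : Function.Bijective (mfderiv I I' f x)) :
    IsLocalDiffeomorphAt I I' ∞ f x := by
  have : IsManifold I 1 N := IsManifold.of_le (n := ∞) (by simp)
  have : IsManifold I' 1 N' := IsManifold.of_le (n := ∞) (by simp)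
  set φ := extChartAt I x with hφ
  set ψ := extChartAt I' (f x) with hψ
  have hz : φ x ∈ φ.target := mem_extChartAt_target x
  have hx : φ.symm (φ x) = x := extChartAt_to_inv x
  have hfx : ContMDiffAt I I' ∞ f x := hf.contMDiffAt hs
  let G : E → E' := fun z => ψ (f (φ.symm z))
  have hcont : Filter.Tendsto φ.symm (𝓝 (φ x)) (𝓝 x) := by
    have := continuousAt_extChartAt_symm (I := I) x
    rwa [ContinuousAt, hx] at this
  have hsi : interior s ∈ 𝓝 x := interior_mem_nhds.2 hs
  have hsrc : ∀ᶠ y in 𝓝 x, f y ∈ ψ.source :=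
    hfx.continuousAt.eventually_mem (extChartAt_source_mem_nhds (I := I') (f x))
  let t : Set E := {z | z ∈ φ.target ∧ φ.symm z ∈ interior s ∧ f (φ.symm z) ∈ ψ.source}
  have ht : t ∈ 𝓝 (φ x) :=
    Filter.Eventually.and ((isOpen_extChartAt_target x).mem_nhds hz)
      ((hcont.eventually hsi).and (hcont.eventually hsrc))
  have hG : ContDiffOn ℝ ∞ G t := by
    rw [← contMDiffOn_iff_contDiffOn]
    intro z hz
    have h1 : ContMDiffAt 𝓘(ℝ, E) I ∞ φ.symm z :=
      (contMDiffOn_extChartAt_symm (I := I) (n := ∞) x).contMDiffAt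
        ((isOpen_extChartAt_target x).mem_nhds hz.1)
    have h2 : ContMDiffAt I I' ∞ f (φ.symm z) :=
      hf.contMDiffAt (mem_interior_iff_mem_nhds.1 hz.2.1)
    have h3 : ContMDiffAt I' 𝓘(ℝ, E') ∞ ψ (f (φ.symm z)) :=
      contMDiffAt_extChartAt' (by rw [← extChartAt_source I']; exact hz.2.2)
    exact (h3.comp z (h2.comp z h1)).contMDiffWithinAt
  obtain ⟨A₁, hA₁⟩ := isInvertible_mfderivWithin_extChartAt_symm (I := I) hz
  obtain ⟨A₃, hA₃⟩ := isInvertible_mfderiv_extChartAt (I := I')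
    (mem_extChartAt_source (I := I') (f x))
  rw [I.range_eq_univ, mfderivWithin_univ] at hA₁
  have hbij : Function.Bijective (fderiv ℝ G (φ x)) := by
    have d1 : MDifferentiableAt 𝓘(ℝ, E) I φ.symm (φ x) :=
      ((contMDiffOn_extChartAt_symm (I := I) (n := ∞) x).contMDiffAt
        ((isOpen_extChartAt_target x).mem_nhds hz)).mdifferentiableAt (by simp)
    have d2 : MDifferentiableAt I I' f (φ.symm (φ x)) := by
      rw [hx]; exact hfx.mdifferentiableAt (by simp)
    have d3 : MDifferentiableAt I' 𝓘(ℝ, E') ψ (f (φ.symm (φ x))) := by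
      rw [hx]; exact mdifferentiableAt_extChartAt (mem_chart_source H' (f x))
    have e1 : fderiv ℝ G (φ x) = (mfderiv I' 𝓘(ℝ, E') ψ (f (φ.symm (φ x)))).comp
        ((mfderiv I I' f (φ.symm (φ x))).comp (mfderiv 𝓘(ℝ, E) I φ.symm (φ x))) := by
      rw [← mfderiv_eq_fderiv]
      change mfderiv _ _ (ψ ∘ (f ∘ φ.symm)) (φ x) = _
      rw [mfderiv_comp (φ x) (g := ψ) d3 (d2.comp (φ x) d1), mfderiv_comp (φ x) d2 d1]
      rfl
    have hb' : Function.Bijective (mfderiv I I' f (φ.symm (φ x))) := by rw [hx]; exact hb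
    have h3 : Function.Bijective (mfderiv I' 𝓘(ℝ, E') ψ (f (φ.symm (φ x)))) := by
      rw [hx, ← hA₃]; exact A₃.bijective
    have h1 : Function.Bijective (mfderiv 𝓘(ℝ, E) I φ.symm (φ x)) := by
      rw [← hA₁]; exact A₁.bijective
    have := h3.comp (hb'.comp h1)
    rw [e1]
    exact this
  have hGd := isLocalDiffeomorphAt_of_fderiv ht hG
    (A := ContinuousLinearEquiv.ofBijective (fderiv ℝ G (φ x))
      (LinearMap.ker_eq_bot.2 hbij.1) (LinearMap.range_eq_top.2 hbij.2)) rfl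
  have hGx : G (φ x) = ψ (f x) := by simp only [G, hx]
  have hψ : IsLocalDiffeomorphAt 𝓘(ℝ, E') I' ∞ ψ.symm (G (φ x)) :=
    isLocalDiffeomorphAt_extChartAt_symm (f x) (by rw [hGx]; exact mem_extChartAt_target (f x))
  have hcomp := ((isLocalDiffeomorphAt_extChartAt (I := I) x).comp _ _ hGd).comp _ _ hψ
  refine IsLocalDiffeomorphAt.congr hcomp ?_
  filter_upwards [extChartAt_source_mem_nhds (I := I) x, hsrc] with y hy hy'
  change f y = ψ.symm (ψ (f (φ.symm (φ y))))
  rw [φ.left_inv hy, ψ.left_inv hy']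

end InverseFunction

/-! ### Functions and maps that are constant along integral curves. -/

section Curves

/-- The target carries no topology, so this applies to points of a manifold and also to families of
propositions, which are thereby propagated along a curve. -/
lemma eq_of_locally_eq {α : Type*} {f : ℝ → α} {S : Set ℝ} (hS : IsPreconnected S)
    (h : ∀ t ∈ S, ∀ᶠ τ in 𝓝[S] t, f τ = f t) {a b : ℝ} (ha : a ∈ S) (hb : b ∈ S) :
    f a = f b := by
  have := isPreconnected_iff_preconnectedSpace.1 hS
  have hloc : IsLocallyConstant (fun t : S => f t) := by
    rw [IsLocallyConstant.iff_eventually_eq]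
    intro t
    have := h t t.2
    rw [nhdsWithin_eq_map_subtype_coe t.2, Filter.eventually_map] at this
    exact this
  exact hloc.apply_eq_of_preconnectedSpace ⟨a, ha⟩ ⟨b, hb⟩

variable {E : Type*} [NormedAddCommGroup E] [NormedSpace ℝ E]
  {H : Type*} [TopologicalSpace H] {I : ModelWithCorners ℝ E H}
  {N : Type*} [TopologicalSpace N] [ChartedSpace H N]
  {F : Type*} [NormedAddCommGroup F] [NormedSpace ℝ F]

lemma hasDerivWithinAt_comp_curve {f : N → F} {γ : ℝ → N} {S : Set ℝ} {t : ℝ}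
    {w : TangentSpace I (γ t)} (hf : MDifferentiableAt I 𝓘(ℝ, F) f (γ t))
    (hγ : HasMFDerivWithinAt 𝓘(ℝ, ℝ) I γ S t ((1 : ℝ →L[ℝ] ℝ).smulRight w)) :
    HasDerivWithinAt (fun τ => f (γ τ)) (vderiv I f (γ t) w) S t := by
  let L : ℝ →L[ℝ] F := (mfderiv I 𝓘(ℝ, F) f (γ t) : E →L[ℝ] F).comp
    ((1 : ℝ →L[ℝ] ℝ).smulRight (w : E))
  have h : HasFDerivWithinAt (fun τ => f (γ τ)) L S t :=
    (hf.hasMFDerivAt.comp_hasMFDerivWithinAt t hγ).hasFDerivWithinAt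
  refine h.hasDerivWithinAt.congr_deriv ?_
  change mfderiv I 𝓘(ℝ, F) f (γ t) ((1 : ℝ) • w) = _
  rw [one_smul]
  rfl

lemma hasDerivAt_comp_curve {f : N → F} {γ : ℝ → N} {t : ℝ}
    {w : TangentSpace I (γ t)} (hf : MDifferentiableAt I 𝓘(ℝ, F) f (γ t))
    (hγ : HasMFDerivAt 𝓘(ℝ, ℝ) I γ t ((1 : ℝ →L[ℝ] ℝ).smulRight w)) :
    HasDerivAt (fun τ => f (γ τ)) (vderiv I f (γ t) w) t := by
  rw [← hasDerivWithinAt_univ]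
  exact hasDerivWithinAt_comp_curve hf hγ.hasMFDerivWithinAt

lemma eq_of_vderiv_eq_zero {f : N → F} {n : ∀ x : N, TangentSpace I x} {γ : ℝ → N} {S : Set ℝ}
    (hS : Convex ℝ S) (hγ : IsMIntegralCurveOn γ n S)
    (hf : ∀ t ∈ S, MDifferentiableAt I 𝓘(ℝ, F) f (γ t) ∧ vderiv I f (γ t) (n (γ t)) = 0)
    {a b : ℝ} (ha : a ∈ S) (hb : b ∈ S) : f (γ b) = f (γ a) := by
  have h := hS.norm_image_sub_le_of_norm_hasDerivWithin_le (f := fun τ => f (γ τ))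
    (f' := fun _ => 0) (C := 0) (fun t ht => by
      have := hasDerivWithinAt_comp_curve (hf t ht).1 (hγ t ht)
      rwa [(hf t ht).2] at this) (fun t _ => by simp) ha hb
  rw [zero_mul] at h
  exact sub_eq_zero.1 (norm_le_zero_iff.1 h)

/-- Functions whose derivatives along `n` vanish near a point of an integral curve are locally
constant along it, on a neighbourhood common to the whole family. -/
lemma eventually_eq_of_vderiv_eq_zero {ι : Type*} {f : ι → N → F}
    {n : ∀ x : N, TangentSpace I x} {γ : ℝ → N} {S : Set ℝ}
    (hS : Convex ℝ S) (hγ : IsMIntegralCurveOn γ n S) {t : ℝ} (ht : t ∈ S)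
    (hf : ∀ᶠ y in 𝓝 (γ t), ∀ i, MDifferentiableAt I 𝓘(ℝ, F) (f i) y ∧
      vderiv I (f i) y (n y) = 0) :
    ∀ᶠ τ in 𝓝[S] t, ∀ i, f i (γ τ) = f i (γ t) := by
  have hc : Filter.Tendsto γ (𝓝[S] t) (𝓝 (γ t)) := hγ.continuousWithinAt ht
  obtain ⟨ε, hε, h⟩ := Metric.mem_nhdsWithin_iff.1 (hc.eventually hf)
  filter_upwards [inter_mem_nhdsWithin S (Metric.ball_mem_nhds t hε)] with τ hτ i
  exact eq_of_vderiv_eq_zero (S := S ∩ Metric.ball t ε) (hS.inter (convex_ball t ε))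
    (hγ.mono inter_subset_left) (fun t' ht' => h ⟨ht'.2, ht'.1⟩ i)
    ⟨ht, Metric.mem_ball_self hε⟩ hτ

variable {E' : Type*} [NormedAddCommGroup E'] [NormedSpace ℝ E']
  {H' : Type*} [TopologicalSpace H'] {I' : ModelWithCorners ℝ E' H'}
  {N' : Type*} [TopologicalSpace N'] [ChartedSpace H' N'] [IsManifold I' ∞ N']

/-- A map that is annihilated by `n` is constant along the integral curves of `n`. -/
lemma eq_of_mfderiv_eq_zero {X : N → N'} {U : Set N} (hU : IsOpen U)
    (hX : ContMDiffOn I I' ∞ X U) {n : ∀ x : N, TangentSpace I x}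
    (hXn : ∀ y ∈ U, mfderiv I I' X y (n y) = 0) {γ : ℝ → N} {S : Set ℝ} (hS : Convex ℝ S)
    (hγ : IsMIntegralCurveOn γ n S) (hγU : ∀ t ∈ S, γ t ∈ U) {a b : ℝ} (ha : a ∈ S) (hb : b ∈ S) :
    X (γ a) = X (γ b) := by
  have : IsManifold I' 1 N' := IsManifold.of_le (n := ∞) (by simp)
  refine eq_of_locally_eq (f := fun t => X (γ t)) hS.isPreconnected (fun t ht => ?_) ha hb
  have hXt : ContinuousAt X (γ t) := (hX.contMDiffAt (hU.mem_nhds (hγU t ht))).continuousAt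
  have hsrc : ∀ᶠ y in 𝓝 (γ t), X y ∈ (extChartAt I' (X (γ t))).source :=
    hXt.eventually_mem (extChartAt_source_mem_nhds (I := I') _)
  have h1 := eventually_eq_of_vderiv_eq_zero (ι := Unit)
    (f := fun _ y => extChartAt I' (X (γ t)) (X y)) hS hγ ht (by
      filter_upwards [hsrc, hU.mem_nhds (hγU t ht)] with y hy hyU _
      have d1 := (hX.contMDiffAt (hU.mem_nhds hyU)).mdifferentiableAt (by simp)
      have d2 := mdifferentiableAt_extChartAt (I := I') (x := X (γ t)) (y := X y)
        (by rwa [extChartAt_source] at hy)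
      refine ⟨d2.comp y d1, ?_⟩
      rw [vderiv_comp d2 d1, hXn y hyU, vderiv_zero])
  have hc : Filter.Tendsto γ (𝓝[S] t) (𝓝 (γ t)) := hγ.continuousWithinAt ht
  filter_upwards [h1, hc.eventually hsrc] with τ hτ hτ'
  exact (extChartAt I' (X (γ t))).injOn hτ' (mem_extChartAt_source _) (hτ ())

end Curves

/-! ### Commuting fields and constancy of derivatives. -/

section Commuting
variable {E : Type*} [NormedAddCommGroup E] [NormedSpace ℝ E] [CompleteSpace E]
  {H : Type*} [TopologicalSpace H] {I : ModelWithCorners ℝ E H} [I.Boundaryless]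
  {N : Type*} [TopologicalSpace N] [ChartedSpace H N] [IsManifold I ∞ N]
  {F : Type*} [NormedAddCommGroup F] [NormedSpace ℝ F]

/-- If `X` and `Y` commute at `x` and `Yf` is constant near `x`, then `Y(Xf) = 0` at `x`. -/
lemma vderiv_vderiv_eq_zero {f : N → F} {X Y : ∀ x : N, TangentSpace I x} {x : N} {c : F}
    (hf : ContMDiffAt I 𝓘(ℝ, F) ∞ f x) (hX : SmoothAt I X x) (hY : SmoothAt I Y x)
    (hXY : mlieBracket I X Y x = 0) (hfY : ∀ᶠ y in 𝓝 x, vderiv I f y (Y y) = c) :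
    vderiv I (fun y => vderiv I f y (X y)) x (Y x) = 0 := by
  have h := vderiv_mlieBracket hf hX hY
  rw [hXY, vderiv_zero, vderiv_congr (f' := fun _ => c) hfY, vderiv_const, zero_sub] at h
  exact neg_eq_zero.1 h.symm

end Commuting

/-! ### Coordinate vector fields. -/

section Frame
variable {E : Type*} [NormedAddCommGroup E] [NormedSpace ℝ E] [CompleteSpace E]
  {H : Type*} [TopologicalSpace H] {I : ModelWithCorners ℝ E H}
  {N : Type*} [TopologicalSpace N] [ChartedSpace H N]
  {F : Type*} [NormedAddCommGroup F] [NormedSpace ℝ F]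

/-- The constant vector field on a vector space. -/
def constField (w : F) : ∀ z : F, TangentSpace 𝓘(ℝ, F) z := fun _ => w

variable (I) in
/-- The coordinate field with constant components `w` in the coordinates `Ψ`. -/
noncomputable def coordField (Ψ : N → F) (w : F) : ∀ x : N, TangentSpace I x :=
  mpullback I 𝓘(ℝ, F) Ψ (constField w)

lemma isInvertible_mfderiv_of_bijective [CompleteSpace F] {Ψ : N → F} {y : N}
    (hb : Function.Bijective (mfderiv I 𝓘(ℝ, F) Ψ y)) :
    (mfderiv I 𝓘(ℝ, F) Ψ y).IsInvertible := by
  let A : E →L[ℝ] F := mfderiv I 𝓘(ℝ, F) Ψ y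
  have hA : Function.Bijective A := hb
  let A' : E ≃L[ℝ] F := ContinuousLinearEquiv.ofBijective A
    (LinearMap.ker_eq_bot.2 hA.1) (LinearMap.range_eq_top.2 hA.2)
  exact ⟨A', rfl⟩

/-- Every tangent vector is thus the value of a coordinate field, so a tensorial identity at a point
need only be tested on coordinate fields. -/
lemma coordField_vderiv [CompleteSpace F] {Ψ : N → F} {y : N} (hb : Function.Bijective (mfderiv I 𝓘(ℝ, F) Ψ y))
    (w : TangentSpace I y) : coordField I Ψ (vderiv I Ψ y w) y = w := by
  obtain ⟨A, hA⟩ := isInvertible_mfderiv_of_bijective hb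
  change (mfderiv I 𝓘(ℝ, F) Ψ y).inverse (mfderiv I 𝓘(ℝ, F) Ψ y w) = w
  rw [← hA, ContinuousLinearMap.inverse_equiv]
  exact A.symm_apply_apply w

variable [IsManifold I ∞ N]

lemma smoothAt_constField (w : F) (z : F) : SmoothAt 𝓘(ℝ, F) (constField w) z :=
  contMDiffAt_vectorSpace_iff_contDiffAt.2 contDiffAt_const

lemma smoothAt_coordField [CompleteSpace F] {Ψ : N → F} {y : N} (hΨ : ContMDiffAt I 𝓘(ℝ, F) ∞ Ψ y)
    (hb : Function.Bijective (mfderiv I 𝓘(ℝ, F) Ψ y)) (w : F) :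
    SmoothAt I (coordField I Ψ w) y := 
  ContMDiffAt.mpullback_vectorField_preimage (smoothAt_constField w (Ψ y)) hΨ
    (isInvertible_mfderiv_of_bijective hb) le_rfl

lemma mlieBracket_coordField [I.Boundaryless] {Ψ : N → F} {y : N}
    (hΨ : ContMDiffAt I 𝓘(ℝ, F) ∞ Ψ y) (w w' : F) :
    mlieBracket I (coordField I Ψ w) (coordField I Ψ w') y = 0 := by
  have : IsManifold I (minSmoothness ℝ 3) N := by
    rw [minSmoothness_of_isRCLikeNormedField]
    exact IsManifold.of_le (n := ∞) (by norm_cast)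
  have h := mpullback_mlieBracket (I := I) (I' := 𝓘(ℝ, F)) (f := Ψ) (x₀ := y) (n := ∞)
    (V := constField w) (W := constField w')
    (SmoothAt.mdifferentiableAt (smoothAt_constField w (Ψ y)))
    (SmoothAt.mdifferentiableAt (smoothAt_constField w' (Ψ y))) hΨ (by
      rw [minSmoothness_of_isRCLikeNormedField]; norm_cast)
  have h0 : mlieBracket 𝓘(ℝ, F) (constField w) (constField w') (Ψ y) = 0 := by
    rw [← mlieBracketWithin_univ, mlieBracketWithin_eq_lieBracketWithin]
    change lieBracketWithin ℝ (fun _ : F => w) (fun _ : F => w') univ (Ψ y) = 0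
    simp [lieBracketWithin]
  unfold coordField
  rw [← h, mpullback_apply, h0]
  exact map_zero _

end Frame

/-! ### Linear algebra of the Lorentzian scalar product. -/

section Metric

variable {m : ℕ} {M : Type*} [TopologicalSpace M]
  [ChartedSpace (EuclideanSpace ℝ (Fin (m + 2))) M] [IsManifold (𝓡 (m + 2)) ∞ M]

lemma LorentzMetric.contMDiffAt_form (g : LorentzMetric m M)
    {X Y : ∀ x : M, TangentSpace (𝓡 (m + 2)) x} {x : M} (hX : SmoothAt (𝓡 (m + 2)) X x)
    (hY : SmoothAt (𝓡 (m + 2)) Y x) :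
    ContMDiffAt (𝓡 (m + 2)) 𝓘(ℝ, ℝ) ∞ (fun y => g.form y (X y) (Y y)) x := by
  have h := ContMDiffAt.clm_bundle_apply₂ (F₁ := EuclideanSpace ℝ (Fin (m + 2)))
    (F₂ := EuclideanSpace ℝ (Fin (m + 2))) (F₃ := ℝ) (E₃ := Bundle.Trivial M ℝ)
    (E₁ := fun x : M => TangentSpace (𝓡 (m + 2)) x) (E₂ := fun x : M => TangentSpace (𝓡 (m + 2)) x)
    (b := id) (IM := 𝓡 (m + 2)) (g.contMDiff x) hX hY
  rw [Bundle.contMDiffAt_totalSpace] at h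
  exact h.2

lemma LorentzMetric.form_symm (g : LorentzMetric m M) (x : M)
    (v w : TangentSpace (𝓡 (m + 2)) x) : g.form x v w = g.form x w v := g.symm x v w

lemma LorentzMetric.form_zero_left (g : LorentzMetric m M) (x : M)
    (w : TangentSpace (𝓡 (m + 2)) x) : g.form x 0 w = 0 := by
  simp [LorentzMetric.form]

lemma LorentzMetric.form_add_right (g : LorentzMetric m M) (x : M)
    (u v w : TangentSpace (𝓡 (m + 2)) x) : g.form x u (v + w) = g.form x u v + g.form x u w := by
  simp [LorentzMetric.form]

lemma LorentzMetric.form_smul_right (g : LorentzMetric m M) (x : M) (c : ℝ)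
    (u v : TangentSpace (𝓡 (m + 2)) x) : g.form x u (c • v) = c * g.form x u v := by
  simp [LorentzMetric.form]

/-- The scalar product in an orthonormal basis. -/
lemma LorentzMetric.exists_coords (g : LorentzMetric m M) (x : M) :
    ∃ e : Module.Basis (Fin (m + 2)) ℝ (TangentSpace (𝓡 (m + 2)) x), ∀ v w,
      g.form x v w = - (e.repr v 0 * e.repr w 0) + ∑ i : Fin (m + 1),
        e.repr v i.succ * e.repr w i.succ := by
  obtain ⟨e, he⟩ := g.signature x
  refine ⟨e, fun v w => ?_⟩
  have h : g.form x v w = ∑ i, ∑ k, e.repr v i * (e.repr w k * g.val x (e i) (e k)) := by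
    conv_lhs => rw [← e.sum_repr v, ← e.sum_repr w]
    simp only [LorentzMetric.form, map_sum, map_smul, FunLike.coe_sum,
      Finset.sum_apply, FunLike.coe_smul, Pi.smul_apply, smul_eq_mul,
      Finset.mul_sum]
    rw [Finset.sum_comm]
    exact Finset.sum_congr rfl fun i _ => Finset.sum_congr rfl fun k _ => mul_left_comm _ _ _
  rw [h]
  simp only [he, mul_ite, mul_one, mul_zero, Finset.sum_ite_eq, Finset.mem_univ, if_true]
  rw [Fin.sum_univ_succ]
  simp [Fin.succ_ne_zero]

lemma LorentzMetric.eq_zero_of_form (g : LorentzMetric m M) {x : M}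
    {v : TangentSpace (𝓡 (m + 2)) x} (h : ∀ w, g.form x v w = 0) : v = 0 := by
  obtain ⟨e, he⟩ := g.exists_coords x
  have h0 := h (e 0)
  rw [he] at h0
  refine e.ext_elem fun i => ?_
  have hi := h (e i)
  rw [he] at hi
  rcases Fin.eq_zero_or_eq_succ i with rfl | ⟨k, rfl⟩
  · simpa [Finsupp.single_apply] using hi
  · simpa [Finsupp.single_apply] using hi

/-- A vector orthogonal to a nonzero null vector `u` and null itself is a multiple of `u`. -/
lemma LorentzMetric.eq_smul_of_null (g : LorentzMetric m M) {x : M}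
    {u v : TangentSpace (𝓡 (m + 2)) x} (hu : u ≠ 0) (huu : g.form x u u = 0)
    (huv : g.form x u v = 0) (hvv : g.form x v v = 0) : ∃ c : ℝ, v = c • u := by
  obtain ⟨e, he⟩ := g.exists_coords x
  rw [he] at huu huv hvv
  -- A null vector without time component has spatial norm zero, hence vanishes.
  have hu0 : e.repr u 0 ≠ 0 := by
    intro h
    refine hu (e.ext_elem fun i => ?_)
    rcases Fin.eq_zero_or_eq_succ i with rfl | ⟨k, rfl⟩
    · simpa using h
    · rw [h] at huu
      have h2 : ∑ i : Fin (m + 1), e.repr u i.succ * e.repr u i.succ = 0 := by linarith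
      rw [Finset.sum_eq_zero_iff_of_nonneg fun i _ => mul_self_nonneg _] at h2
      simpa using h2 k (Finset.mem_univ k)
  set a := e.repr u 0 with ha
  set b := e.repr v 0 with hb
  -- The combination $a v-b u$ is null and has zero time component, so its spatial part vanishes as
  -- well.
  have hsum : ∑ i : Fin (m + 1), (a * e.repr v i.succ - b * e.repr u i.succ) ^ 2 = 0 := by
    have : ∀ i : Fin (m + 1), (a * e.repr v i.succ - b * e.repr u i.succ) ^ 2 =
        a ^ 2 * (e.repr v i.succ * e.repr v i.succ)
          - 2 * a * b * (e.repr u i.succ * e.repr v i.succ)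
          + b ^ 2 * (e.repr u i.succ * e.repr u i.succ) := fun i => by ring
    simp only [this, Finset.sum_add_distrib, Finset.sum_sub_distrib, ← Finset.mul_sum]
    linear_combination a ^ 2 * hvv - 2 * a * b * huv + b ^ 2 * huu
  rw [Finset.sum_eq_zero_iff_of_nonneg fun i _ => sq_nonneg _] at hsum
  refine ⟨b / a, e.ext_elem fun i => ?_⟩
  rcases Fin.eq_zero_or_eq_succ i with rfl | ⟨k, rfl⟩
  · simp only [map_smul, Finsupp.smul_apply, smul_eq_mul, ← ha, ← hb]
    field_simp
  · have := pow_eq_zero_iff (two_ne_zero) |>.1 (hsum k (Finset.mem_univ k))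
    simp only [map_smul, Finsupp.smul_apply, smul_eq_mul]
    field_simp
    linarith

end Metric

/-! ### Bondi-like coordinates and their coordinate fields. -/

section Bondi

variable {m : ℕ} {M : Type*} [TopologicalSpace M]
  [ChartedSpace (EuclideanSpace ℝ (Fin (m + 2))) M] [IsManifold (𝓡 (m + 2)) ∞ M]
  {B : Type*} [TopologicalSpace B] [ChartedSpace (EuclideanSpace ℝ (Fin m)) B]
  [IsManifold (𝓡 m) ∞ B]

/-- With $g(n,n)=0$ and $[n,Z]=0$, all terms of the Koszul formula drop out except two equal ones,
$n\,g(n,Z)$. -/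
lemma koszul_eq_of_commute (g : LorentzMetric m M) {n Z : ∀ x : M, TangentSpace (𝓡 (m + 2)) x}
    {y : M} (hnn : ∀ᶠ z in 𝓝 y, g.form z (n z) (n z) = 0)
    (hnZ : mlieBracket (𝓡 (m + 2)) n Z y = 0) :
    koszul (𝓡 (m + 2)) g.form n n Z y =
      vderiv (𝓡 (m + 2)) (fun z => g.form z (n z) (Z z)) y (n y) := by
  have h1 : mlieBracket (𝓡 (m + 2)) Z n y = 0 := by rw [mlieBracket_swap_apply, hnZ, neg_zero]
  have h2 : (fun z => g.form z (Z z) (n z)) = fun z => g.form z (n z) (Z z) :=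
    funext fun z => g.form_symm _ _ _
  unfold koszul
  rw [hnZ, h1, mlieBracket_self, h2]
  simp only [dirDeriv_eq_vderiv]
  rw [vderiv_congr (f' := fun _ => (0 : ℝ)) hnn, vderiv_const]
  simp only [Pi.zero_apply, g.form_zero_left]
  ring

variable {g : LorentzMetric m M} {j : B × ℝ → M} {v : B × ℝ → ℝ} {U : Set M}
  {n ζ : ∀ x : M, TangentSpace (𝓡 (m + 2)) x} {X : M → B} {V r : M → ℝ}

variable (m) in
/-- The Bondi-like coordinates, with respect to a chart of the base. -/
noncomputable def bondiChart (c : B) (X : M → B) (V r : M → ℝ) (y : M) :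
    EuclideanSpace ℝ (Fin m) × ℝ × ℝ :=
  (extChartAt (𝓡 m) c (X y), V y, r y)

lemma isOpen_bondiDomain (hB : IsBondiLike g j v U n ζ X V r) (c : B) :
    IsOpen (U ∩ X ⁻¹' (extChartAt (𝓡 m) c).source) :=
  hB.X_smooth.continuousOn.isOpen_inter_preimage hB.isOpen (isOpen_extChartAt_source c)

lemma contMDiffAt_chart_comp (hB : IsBondiLike g j v U n ζ X V r) {c : B} {y : M}
    (hy : y ∈ U ∩ X ⁻¹' (extChartAt (𝓡 m) c).source) :
    ContMDiffAt (𝓡 (m + 2)) 𝓘(ℝ, EuclideanSpace ℝ (Fin m)) ∞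
      (fun z => extChartAt (𝓡 m) c (X z)) y := by
  have h1 := hB.X_smooth.contMDiffAt (hB.isOpen.mem_nhds hy.1)
  have h2 : ContMDiffAt (𝓡 m) 𝓘(ℝ, EuclideanSpace ℝ (Fin m)) ∞ (extChartAt (𝓡 m) c) (X y) :=
    contMDiffAt_extChartAt' (by rw [← extChartAt_source (𝓡 m)]; exact hy.2)
  exact h2.comp y h1

lemma contMDiffAt_bondiChart (hB : IsBondiLike g j v U n ζ X V r) {c : B} {y : M}
    (hy : y ∈ U ∩ X ⁻¹' (extChartAt (𝓡 m) c).source) :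
    ContMDiffAt (𝓡 (m + 2)) 𝓘(ℝ, EuclideanSpace ℝ (Fin m) × ℝ × ℝ) ∞
      (bondiChart m c X V r) y :=
  (contMDiffAt_chart_comp hB hy).prodMk_space
    ((hB.V_smooth.contMDiffAt (hB.isOpen.mem_nhds hy.1)).prodMk_space
      (hB.r_smooth.contMDiffAt (hB.isOpen.mem_nhds hy.1)))

lemma vderiv_chart_comp (hB : IsBondiLike g j v U n ζ X V r) {c : B} {y : M}
    (hy : y ∈ U ∩ X ⁻¹' (extChartAt (𝓡 m) c).source) (w : TangentSpace (𝓡 (m + 2)) y) :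
    vderiv (𝓡 (m + 2)) (fun z => extChartAt (𝓡 m) c (X z)) y w =
      vderiv (𝓡 m) (extChartAt (𝓡 m) c) (X y) (mfderiv (𝓡 (m + 2)) (𝓡 m) X y w) := by
  have : IsManifold (𝓡 m) 1 B := IsManifold.of_le (n := ∞) (by simp)
  have h1 := hB.X_smooth.contMDiffAt (hB.isOpen.mem_nhds hy.1)
  exact vderiv_comp (mdifferentiableAt_extChartAt (by rw [← extChartAt_source (𝓡 m)]; exact hy.2))
    (h1.mdifferentiableAt (by simp)) w

lemma vderiv_extChartAt_bijective {c x : B} (hx : x ∈ (extChartAt (𝓡 m) c).source) :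
    Function.Bijective (vderiv (𝓡 m) (extChartAt (𝓡 m) c) x) := by
  have : IsManifold (𝓡 m) 1 B := IsManifold.of_le (n := ∞) (by simp)
  obtain ⟨A, hA⟩ := isInvertible_mfderiv_extChartAt (I := 𝓡 m) hx
  change Function.Bijective (mfderiv (𝓡 m) 𝓘(ℝ, EuclideanSpace ℝ (Fin m)) (extChartAt (𝓡 m) c) x)
  rw [← hA]
  exact A.bijective

lemma vderiv_bondiChart (hB : IsBondiLike g j v U n ζ X V r) {c : B} {y : M}
    (hy : y ∈ U ∩ X ⁻¹' (extChartAt (𝓡 m) c).source) (w : TangentSpace (𝓡 (m + 2)) y) :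
    vderiv (𝓡 (m + 2)) (bondiChart m c X V r) y w =
      (vderiv (𝓡 m) (extChartAt (𝓡 m) c) (X y) (mfderiv (𝓡 (m + 2)) (𝓡 m) X y w),
        dirDeriv (𝓡 (m + 2)) V y w, dirDeriv (𝓡 (m + 2)) r y w) := by
  rw [← vderiv_chart_comp hB hy]
  have d2 := (hB.V_smooth.contMDiffAt (hB.isOpen.mem_nhds hy.1)).mdifferentiableAt (by simp)
  have d3 := (hB.r_smooth.contMDiffAt (hB.isOpen.mem_nhds hy.1)).mdifferentiableAt (by simp)
  refine (vderiv_prodMk ((contMDiffAt_chart_comp hB hy).mdifferentiableAt (by simp))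
    (d2.prodMk_space d3) w).trans ?_
  rw [vderiv_prodMk d2 d3]
  rfl

lemma bijective_mfderiv_bondiChart (hB : IsBondiLike g j v U n ζ X V r) {c : B} {y : M}
    (hy : y ∈ U ∩ X ⁻¹' (extChartAt (𝓡 m) c).source) :
    Function.Bijective (mfderiv (𝓡 (m + 2)) 𝓘(ℝ, EuclideanSpace ℝ (Fin m) × ℝ × ℝ)
      (bondiChart m c X V r) y) := by
  have h := (Function.Bijective.prodMap (vderiv_extChartAt_bijective hy.2)
    (Function.bijective_id (α := ℝ × ℝ))).comp (hB.bijective y hy.1)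
  have he : vderiv (𝓡 (m + 2)) (bondiChart m c X V r) y = _ := funext (vderiv_bondiChart hB hy)
  change Function.Bijective (vderiv (𝓡 (m + 2)) (bondiChart m c X V r) y)
  rw [he]
  exact h

lemma vderiv_bondiChart_n (hB : IsBondiLike g j v U n ζ X V r) {c : B} {y : M}
    (hy : y ∈ U ∩ X ⁻¹' (extChartAt (𝓡 m) c).source) :
    vderiv (𝓡 (m + 2)) (bondiChart m c X V r) y (n y) = (0, 0, -1) := by
  rw [vderiv_bondiChart hB hy, hB.X_n y hy.1, hB.V_n y hy.1, hB.r_n y hy.1, vderiv_zero]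

/-- The field $n$ is $-\partial_r$, which is why it commutes with every coordinate field. -/
lemma n_eventuallyEq_coordField (hB : IsBondiLike g j v U n ζ X V r) {c : B} {y : M}
    (hy : y ∈ U ∩ X ⁻¹' (extChartAt (𝓡 m) c).source) :
    n =ᶠ[𝓝 y] coordField (𝓡 (m + 2)) (bondiChart m c X V r) (0, 0, -1) := by
  filter_upwards [(isOpen_bondiDomain hB c).mem_nhds hy] with z hz
  rw [← vderiv_bondiChart_n hB hz, coordField_vderiv (bijective_mfderiv_bondiChart hB hz)]

lemma mlieBracket_n_coordField (hB : IsBondiLike g j v U n ζ X V r) {c : B} {y : M}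
    (hy : y ∈ U ∩ X ⁻¹' (extChartAt (𝓡 m) c).source) (w : EuclideanSpace ℝ (Fin m) × ℝ × ℝ) :
    mlieBracket (𝓡 (m + 2)) n (coordField (𝓡 (m + 2)) (bondiChart m c X V r) w) y = 0 := by
  refine (Filter.EventuallyEq.mlieBracket_vectorField_eq (n_eventuallyEq_coordField hB hy)
    Filter.EventuallyEq.rfl).trans ?_
  exact mlieBracket_coordField (contMDiffAt_bondiChart hB hy) _ _

lemma smoothAt_bondi_coordField (hB : IsBondiLike g j v U n ζ X V r) {c : B} {y : M}
    (hy : y ∈ U ∩ X ⁻¹' (extChartAt (𝓡 m) c).source) (w : EuclideanSpace ℝ (Fin m) × ℝ × ℝ) :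
    SmoothAt (𝓡 (m + 2)) (coordField (𝓡 (m + 2)) (bondiChart m c X V r) w) y :=
  smoothAt_coordField (contMDiffAt_bondiChart hB hy) (bijective_mfderiv_bondiChart hB hy) w

lemma mfderiv_X_push (hj : ContMDiff (HModel m) (𝓡 (m + 2)) ∞ j)
    (hB : IsBondiLike g j v U n ζ X V r) (p : B × ℝ) (w : TangentSpace (HModel m) p) :
    (mfderiv (𝓡 (m + 2)) (𝓡 m) X (j p) (push j p w) : EuclideanSpace ℝ (Fin m)) =
      baseComp p w := by
  have hU : j p ∈ U := hB.range_subset ⟨p, rfl⟩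
  have d1 := (hB.X_smooth.contMDiffAt (hB.isOpen.mem_nhds hU)).mdifferentiableAt (by simp)
  have d2 := (hj p).mdifferentiableAt (by simp)
  have h := mfderiv_comp p d1 d2
  have hcongr : ∀ f f' : B × ℝ → B, f = f' →
      (mfderiv (HModel m) (𝓡 m) f p w : EuclideanSpace ℝ (Fin m)) =
        mfderiv (HModel m) (𝓡 m) f' p w := by
    rintro f _ rfl; rfl
  unfold baseComp
  rw [← hcongr (X ∘ j) Prod.fst (funext hB.X_horizon), h]
  rfl

lemma dirDeriv_push (hj : ContMDiff (HModel m) (𝓡 (m + 2)) ∞ j) (hU : IsOpen U)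
    {f : M → ℝ} (hf : ContMDiffOn (𝓡 (m + 2)) 𝓘(ℝ, ℝ) ∞ f U) {f' : B × ℝ → ℝ}
    (hff' : ∀ p, f (j p) = f' p) {p : B × ℝ} (hp : j p ∈ U) (w : TangentSpace (HModel m) p) :
    dirDeriv (𝓡 (m + 2)) f (j p) (push j p w) = dirDeriv (HModel m) f' p w := by
  have d1 := (hf.contMDiffAt (hU.mem_nhds hp)).mdifferentiableAt (by simp)
  have d2 := (hj p).mdifferentiableAt (by simp)
  rw [dirDeriv_eq_vderiv, dirDeriv_eq_vderiv, ← funext hff', vderiv_comp d1 d2]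
  rfl

lemma exists_tangent_of_isHorizonCoordinate (hv : IsHorizonCoordinate m v) (p : B × ℝ)
    (ξ : EuclideanSpace ℝ (Fin m)) (c : ℝ) :
    ∃ w : TangentSpace (HModel m) p, (baseComp p w : EuclideanSpace ℝ (Fin m)) = ξ ∧
      dirDeriv (HModel m) v p w = c := by
  have : IsManifold (𝓡 m) 1 B := IsManifold.of_le (n := ∞) (by simp)
  have hd := ((hv.localDiffeo p).mfderivToContinuousLinearEquiv (by simp)).surjective (ξ, c)
  obtain ⟨w, hw⟩ := hd
  have hm := mfderiv_prodMk (I := HModel m) (I' := 𝓡 m) (I'' := 𝓘(ℝ, ℝ)) (x := p)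
    (f := (Prod.fst : B × ℝ → B)) (g := v) mdifferentiableAt_fst
    ((hv.smooth p).mdifferentiableAt (by simp))
  have hw' : mfderiv (HModel m) (HModel m) (fun q : B × ℝ => (q.1, v q)) p w = (ξ, c) := hw
  rw [hm] at hw'
  exact ⟨w, congrArg Prod.fst hw', congrArg Prod.snd hw'⟩

end Bondi

/-! ### The Killing field in Bondi-like coordinates. -/

section BondiKilling

variable {m : ℕ} {M : Type*} [TopologicalSpace M]
  [ChartedSpace (EuclideanSpace ℝ (Fin (m + 2))) M] [IsManifold (𝓡 (m + 2)) ∞ M]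
  {B : Type*} [TopologicalSpace B] [ChartedSpace (EuclideanSpace ℝ (Fin m)) B]
  [IsManifold (𝓡 m) ∞ B]
  {g : LorentzMetric m M} {j : B × ℝ → M} {v : B × ℝ → ℝ} {U : Set M}
  {n ζ : ∀ x : M, TangentSpace (𝓡 (m + 2)) x} {X : M → B} {V r : M → ℝ}

/-- Any vector at a horizon point is tangent to the horizon up to a multiple of $n$, and on $n$ both
sides vanish. -/
lemma form_n_horizon (hj : ContMDiff (HModel m) (𝓡 (m + 2)) ∞ j)
    (hv : IsHorizonCoordinate m v) (hB : IsBondiLike g j v U n ζ X V r) (p : B × ℝ)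
    (Z : TangentSpace (𝓡 (m + 2)) (j p)) :
    g.form (j p) (n (j p)) Z = - vderiv (𝓡 (m + 2)) V (j p) Z := by
  have hU : j p ∈ U := hB.range_subset ⟨p, rfl⟩
  set c := vderiv (𝓡 (m + 2)) r (j p) Z with hc
  obtain ⟨w, hw1, hw2⟩ := exists_tangent_of_isHorizonCoordinate hv p
    (mfderiv (𝓡 (m + 2)) (𝓡 m) X (j p) (Z + c • n (j p)))
    (dirDeriv (𝓡 (m + 2)) V (j p) (Z + c • n (j p)))
  -- Since $n(r)=-1$, adding $(Zr)\,n$ cancels the $r$-component of `Z`; a vector with no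
  -- $r$-component comes from the horizon.
  have hpush : push j p w = Z + c • n (j p) := by
    refine (hB.bijective (j p) hU).1 (Prod.ext ?_ (Prod.ext ?_ ?_))
    · exact (mfderiv_X_push hj hB p w).trans hw1
    · exact (dirDeriv_push hj hB.isOpen hB.V_smooth hB.V_horizon hU w).trans hw2
    · refine (dirDeriv_push hj hB.isOpen hB.r_smooth hB.r_horizon hU w).trans ?_
      have h1 := hB.r_n _ hU
      simp only [dirDeriv_eq_vderiv] at h1 ⊢
      rw [vderiv_const, vderiv_add, vderiv_smul, h1, ← hc]
      simp
  have h := hB.n_horizon p w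
  have h2 := hB.V_n _ hU
  rw [dirDeriv_eq_vderiv] at h2
  rw [← dirDeriv_push hj hB.isOpen hB.V_smooth hB.V_horizon hU, hpush, g.form_add_right,
    g.form_smul_right, hB.n_null _ hU, dirDeriv_eq_vderiv, vderiv_add, vderiv_smul, h2] at h
  simpa using h

lemma vderiv_form_n_coordField (hB : IsBondiLike g j v U n ζ X V r) {c : B} {y : M}
    (hy : y ∈ U ∩ X ⁻¹' (extChartAt (𝓡 m) c).source) (w : EuclideanSpace ℝ (Fin m) × ℝ × ℝ) :
    vderiv (𝓡 (m + 2)) (fun z => g.form z (n z)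
      (coordField (𝓡 (m + 2)) (bondiChart m c X V r) w z)) y (n y) = 0 := by
  have hnn : ∀ᶠ z in 𝓝 y, g.form z (n z) (n z) = 0 := by
    filter_upwards [hB.isOpen.mem_nhds hy.1] with z hz using hB.n_null z hz
  rw [← koszul_eq_of_commute g hnn (mlieBracket_n_coordField hB hy w)]
  exact hB.n_geodesic y hy.1 _ (smoothAt_bondi_coordField hB hy w)

lemma vderiv_vderiv_V_coordField (hB : IsBondiLike g j v U n ζ X V r) {c : B} {y : M}
    (hy : y ∈ U ∩ X ⁻¹' (extChartAt (𝓡 m) c).source) (w : EuclideanSpace ℝ (Fin m) × ℝ × ℝ) :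
    vderiv (𝓡 (m + 2)) (fun z => vderiv (𝓡 (m + 2)) V z
      (coordField (𝓡 (m + 2)) (bondiChart m c X V r) w z)) y (n y) = 0 := by
  refine vderiv_vderiv_eq_zero (c := 0) (hB.V_smooth.contMDiffAt (hB.isOpen.mem_nhds hy.1))
    (smoothAt_bondi_coordField hB hy w) (hB.n_smooth y hy.1) ?_ ?_
  · rw [mlieBracket_swap_apply, mlieBracket_n_coordField hB hy, neg_zero]
  · filter_upwards [hB.isOpen.mem_nhds hy.1] with z hz using hB.V_n z hz

/-- In Bondi-like coordinates, `g(n, ·) = -dV`. -/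
lemma form_n (hj : ContMDiff (HModel m) (𝓡 (m + 2)) ∞ j)
    (hv : IsHorizonCoordinate m v) (hB : IsBondiLike g j v U n ζ X V r) {y : M} (hy : y ∈ U)
    (Z : TangentSpace (𝓡 (m + 2)) y) :
    g.form y (n y) Z = - vderiv (𝓡 (m + 2)) V y Z := by
  obtain ⟨p, s, γ, hγ, hγU, h0, rfl⟩ := hB.n_foliates y hy
  let P : ℝ → Prop := fun τ => ∀ Z : TangentSpace (𝓡 (m + 2)) (γ τ),
    g.form (γ τ) (n (γ τ)) Z = - vderiv (𝓡 (m + 2)) V (γ τ) Z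
  have hP0 : P 0 := by
    change ∀ Z : TangentSpace (𝓡 (m + 2)) (γ 0), _
    rw [h0]
    exact form_n_horizon hj hv hB p
  -- The truth value of `P` is shown to be locally constant along the curve.
  suffices h : P 0 = P s from (h ▸ hP0 : P s) Z
  have hconv : Convex ℝ (uIcc 0 s) := convex_uIcc 0 s
  refine eq_of_locally_eq hconv.isPreconnected (fun t ht => ?_) left_mem_uIcc right_mem_uIcc
  set c := X (γ t) with hc
  have hyt : γ t ∈ U ∩ X ⁻¹' (extChartAt (𝓡 m) c).source :=
    ⟨hγU t ht, mem_extChartAt_source (I := 𝓡 m) c⟩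
  let A : EuclideanSpace ℝ (Fin m) × ℝ × ℝ → M → ℝ × ℝ := fun w z =>
    (g.form z (n z) (coordField (𝓡 (m + 2)) (bondiChart m c X V r) w z),
      vderiv (𝓡 (m + 2)) V z (coordField (𝓡 (m + 2)) (bondiChart m c X V r) w z))
  have hG := (isOpen_bondiDomain hB c).mem_nhds hyt
  have hPA : ∀ τ, γ τ ∈ U ∩ X ⁻¹' (extChartAt (𝓡 m) c).source →
      (P τ ↔ ∀ w, (A w (γ τ)).1 = - (A w (γ τ)).2) := by
    intro τ hτ
    refine ⟨fun h w => h _, fun h Z => ?_⟩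
    have := h (vderiv (𝓡 (m + 2)) (bondiChart m c X V r) (γ τ) Z)
    simp only [A] at this
    rwa [coordField_vderiv (bijective_mfderiv_bondiChart hB hτ)] at this
  -- One neighbourhood must serve all `w` at once, because `P` quantifies over all tangent vectors.
  have hev := eventually_eq_of_vderiv_eq_zero (f := A) hconv hγ ht (by
    filter_upwards [hG] with z hz w
    have d1 := (g.contMDiffAt_form (hB.n_smooth z hz.1)
      (smoothAt_bondi_coordField hB hz w)).mdifferentiableAt (by simp)
    have d2 := (SmoothAt.contMDiffAt_vderiv (hB.V_smooth.contMDiffAt (hB.isOpen.mem_nhds hz.1))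
      (smoothAt_bondi_coordField hB hz w)).mdifferentiableAt (by simp)
    refine ⟨d1.prodMk_space d2, (vderiv_prodMk d1 d2 _).trans ?_⟩
    rw [vderiv_form_n_coordField hB hz, vderiv_vderiv_V_coordField hB hz]
    rfl)
  filter_upwards [hev, (hγ.continuousWithinAt ht).eventually hG] with τ hτ hτG
  refine propext ?_
  rw [hPA τ hτG, hPA t hyt]
  simp only [hτ]

lemma vderiv_neg {f : M → ℝ} {y : M} (w : TangentSpace (𝓡 (m + 2)) y) :
    vderiv (𝓡 (m + 2)) (fun z => - f z) y w = - vderiv (𝓡 (m + 2)) f y w := by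
  have h := mfderiv_neg (I := 𝓡 (m + 2)) (f := f) (x := y)
  unfold vderiv
  change mfderiv (𝓡 (m + 2)) 𝓘(ℝ, ℝ) (-f) y w = _
  rw [h]
  rfl

/-- `g([K, n], ·) = -d(K V)` for a Killing field `K`. -/
lemma form_mlieBracket_n (hj : ContMDiff (HModel m) (𝓡 (m + 2)) ∞ j)
    (hv : IsHorizonCoordinate m v) (hB : IsBondiLike g j v U n ζ X V r)
    {K : ∀ x : M, TangentSpace (𝓡 (m + 2)) x} (hK : IsKilling g K) {y : M} (hy : y ∈ U)
    {Z : ∀ x : M, TangentSpace (𝓡 (m + 2)) x} (hZ : SmoothAt (𝓡 (m + 2)) Z y) :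
    g.form y (mlieBracket (𝓡 (m + 2)) K n y) (Z y) =
      - vderiv (𝓡 (m + 2)) (fun z => vderiv (𝓡 (m + 2)) V z (K z)) y (Z y) := by
  have h := hK.2 y n Z (hB.n_smooth y hy) hZ
  have h1 : (fun z => g.form z (n z) (Z z)) =ᶠ[𝓝 y]
      fun z => - vderiv (𝓡 (m + 2)) V z (Z z) := by
    filter_upwards [hB.isOpen.mem_nhds hy] with z hz using form_n hj hv hB hz _
  unfold lieForm at h
  rw [dirDeriv_eq_vderiv, vderiv_congr h1, vderiv_neg, form_n hj hv hB hy,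
    vderiv_mlieBracket (hB.V_smooth.contMDiffAt (hB.isOpen.mem_nhds hy)) (hK.1 y) hZ] at h
  linarith

/-- The Killing equation on the pair $(n,n)$, with $g(n,n)=0$, gives $g([K,n],n)=0$; by
`form_mlieBracket_n` this is $-n(KV)$. -/
lemma vderiv_vderiv_V_n (hj : ContMDiff (HModel m) (𝓡 (m + 2)) ∞ j)
    (hv : IsHorizonCoordinate m v) (hB : IsBondiLike g j v U n ζ X V r)
    {K : ∀ x : M, TangentSpace (𝓡 (m + 2)) x} (hK : IsKilling g K) {y : M} (hy : y ∈ U) :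
    vderiv (𝓡 (m + 2)) (fun z => vderiv (𝓡 (m + 2)) V z (K z)) y (n y) = 0 := by
  have h := hK.2 y n n (hB.n_smooth y hy) (hB.n_smooth y hy)
  have h1 : (fun z => g.form z (n z) (n z)) =ᶠ[𝓝 y] fun _ => (0 : ℝ) := by
    filter_upwards [hB.isOpen.mem_nhds hy] with z hz using hB.n_null z hz
  unfold lieForm at h
  rw [dirDeriv_eq_vderiv, vderiv_congr h1, vderiv_const,
    g.form_symm y (n y) (mlieBracket (𝓡 (m + 2)) K n y)] at h
  have h2 := form_mlieBracket_n hj hv hB hK hy (hB.n_smooth y hy)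
  linarith

variable {K : ∀ x : M, TangentSpace (𝓡 (m + 2)) x} {k : ∀ p : B × ℝ, TangentSpace (HModel m) p}
  {a : ℝ}

lemma vderiv_V_killing (hj : ContMDiff (HModel m) (𝓡 (m + 2)) ∞ j)
    (hv : IsHorizonCoordinate m v) (hB : IsBondiLike g j v U n ζ X V r)
    (hK : IsKilling g K) (hk : IsRestriction j K k)
    (ha : ∀ p, dirDeriv (HModel m) v p (k p) = a) {y : M} (hy : y ∈ U) :
    vderiv (𝓡 (m + 2)) V y (K y) = a := by
  obtain ⟨p, s, γ, hγ, hγU, h0, rfl⟩ := hB.n_foliates y hy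
  have h := eq_of_vderiv_eq_zero (f := fun z => vderiv (𝓡 (m + 2)) V z (K z)) (convex_uIcc 0 s) hγ
    (fun t ht => ⟨(SmoothAt.contMDiffAt_vderiv (hB.V_smooth.contMDiffAt
      (hB.isOpen.mem_nhds (hγU t ht))) (hK.1 _)).mdifferentiableAt (by simp),
      vderiv_vderiv_V_n hj hv hB hK (hγU t ht)⟩) left_mem_uIcc right_mem_uIcc
  refine h.trans ?_
  have hp : j p ∈ U := hB.range_subset ⟨p, rfl⟩
  rw [h0, ← hk.2 p, ← dirDeriv_eq_vderiv, dirDeriv_push hj hB.isOpen hB.V_smooth hB.V_horizon hp, ha]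

/-- Now that $KV$ is constant on `U`, $-d(KV)$ vanishes and nondegeneracy of $g$ applies. -/
lemma mlieBracket_killing_n (hj : ContMDiff (HModel m) (𝓡 (m + 2)) ∞ j)
    (hv : IsHorizonCoordinate m v) (hB : IsBondiLike g j v U n ζ X V r)
    (hK : IsKilling g K) (hk : IsRestriction j K k)
    (ha : ∀ p, dirDeriv (HModel m) v p (k p) = a) {y : M} (hy : y ∈ U) :
    mlieBracket (𝓡 (m + 2)) K n y = 0 := by
  have hyG : y ∈ U ∩ X ⁻¹' (extChartAt (𝓡 m) (X y)).source :=
    ⟨hy, mem_extChartAt_source (I := 𝓡 m) (X y)⟩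
  refine g.eq_zero_of_form fun Z => ?_
  have h := form_mlieBracket_n hj hv hB hK hy (smoothAt_bondi_coordField hB hyG
    (vderiv (𝓡 (m + 2)) (bondiChart m (X y) X V r) y Z))
  rw [coordField_vderiv (bijective_mfderiv_bondiChart hB hyG)] at h
  rw [h, vderiv_congr (f' := fun _ => a), vderiv_const, neg_zero]
  filter_upwards [hB.isOpen.mem_nhds hy] with z hz using vderiv_V_killing hj hv hB hK hk ha hz

/-- From $[K,n]=0$ and $n(r)=-1$ one gets $n(Kr)=0$; on the horizon $Kr=0$ because $K$ is tangent to
it. -/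
lemma vderiv_r_killing (hj : ContMDiff (HModel m) (𝓡 (m + 2)) ∞ j)
    (hv : IsHorizonCoordinate m v) (hB : IsBondiLike g j v U n ζ X V r)
    (hK : IsKilling g K) (hk : IsRestriction j K k)
    (ha : ∀ p, dirDeriv (HModel m) v p (k p) = a) {y : M} (hy : y ∈ U) :
    vderiv (𝓡 (m + 2)) r y (K y) = 0 := by
  obtain ⟨p, s, γ, hγ, hγU, h0, rfl⟩ := hB.n_foliates y hy
  have h := eq_of_vderiv_eq_zero (f := fun z => vderiv (𝓡 (m + 2)) r z (K z)) (convex_uIcc 0 s) hγ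
    (fun t ht => by
      have hr := hB.r_smooth.contMDiffAt (hB.isOpen.mem_nhds (hγU t ht))
      refine ⟨(SmoothAt.contMDiffAt_vderiv hr (hK.1 _)).mdifferentiableAt (by simp),
        vderiv_vderiv_eq_zero (c := -1) hr (hK.1 _) (hB.n_smooth _ (hγU t ht))
          (mlieBracket_killing_n hj hv hB hK hk ha (hγU t ht)) ?_⟩
      filter_upwards [hB.isOpen.mem_nhds (hγU t ht)] with z hz using hB.r_n z hz)
    left_mem_uIcc right_mem_uIcc
  refine h.trans ?_
  have hp : j p ∈ U := hB.range_subset ⟨p, rfl⟩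
  rw [h0, ← hk.2 p, ← dirDeriv_eq_vderiv, dirDeriv_push hj hB.isOpen hB.r_smooth hB.r_horizon hp,
    dirDeriv_eq_vderiv, vderiv_const]

lemma mfderiv_X_killing [T2Space B] (hj : ContMDiff (HModel m) (𝓡 (m + 2)) ∞ j)
    (hv : IsHorizonCoordinate m v) (hB : IsBondiLike g j v U n ζ X V r)
    (hK : IsKilling g K) (hk : IsRestriction j K k)
    (ha : ∀ p, dirDeriv (HModel m) v p (k p) = a) {Φ : ∀ x : B, TangentSpace (𝓡 m) x}
    (hΦ : ∀ p, baseComp p (k p) = Φ p.1) {y : M} (hy : y ∈ U) :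
    mfderiv (𝓡 (m + 2)) (𝓡 m) X y (K y) = Φ (X y) := by
  obtain ⟨p, s, γ, hγ, hγU, h0, rfl⟩ := hB.n_foliates y hy
  set x := X (γ s) with hx
  -- The base point does not move along the curve, so a single chart of `B` serves the whole curve.
  have hXx : ∀ t ∈ uIcc 0 s, X (γ t) = x := fun t ht =>
    eq_of_mfderiv_eq_zero hB.isOpen hB.X_smooth hB.X_n (convex_uIcc 0 s) hγ hγU ht right_mem_uIcc
  have hG : ∀ t ∈ uIcc 0 s, γ t ∈ U ∩ X ⁻¹' (extChartAt (𝓡 m) x).source := fun t ht =>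
    ⟨hγU t ht, by rw [mem_preimage, hXx t ht]; exact mem_extChartAt_source (I := 𝓡 m) x⟩
  have h := eq_of_vderiv_eq_zero (f := fun z => vderiv (𝓡 (m + 2))
      (fun z => extChartAt (𝓡 m) x (X z)) z (K z)) (convex_uIcc 0 s) hγ
    (fun t ht => by
      have hr := contMDiffAt_chart_comp hB (hG t ht)
      refine ⟨(SmoothAt.contMDiffAt_vderiv hr (hK.1 _)).mdifferentiableAt (by simp),
        vderiv_vderiv_eq_zero (c := 0) hr (hK.1 _) (hB.n_smooth _ (hγU t ht))
          (mlieBracket_killing_n hj hv hB hK hk ha (hγU t ht)) ?_⟩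
      filter_upwards [(isOpen_bondiDomain hB x).mem_nhds (hG t ht)] with z hz
      rw [vderiv_chart_comp hB hz, hB.X_n z hz.1, vderiv_zero])
    left_mem_uIcc right_mem_uIcc
  have hp : j p ∈ U := hB.range_subset ⟨p, rfl⟩
  have hXp : p.1 = x := by rw [← hXx 0 left_mem_uIcc, h0, hB.X_horizon]
  have hG0 := hG 0 left_mem_uIcc
  rw [h0] at h hG0
  rw [vderiv_chart_comp hB (hG s right_mem_uIcc), vderiv_chart_comp hB hG0, ← hk.2 p] at h
  -- `X (j p)` and `x` are equal but not definitionally, so vectors are compared in the common model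
  -- space.
  have htr : ∀ (x' : B) (_ : x' = x) (w : EuclideanSpace ℝ (Fin m)),
      vderiv (𝓡 m) (extChartAt (𝓡 m) x) x' w = vderiv (𝓡 m) (extChartAt (𝓡 m) x) x w := by
    rintro _ rfl w; rfl
  have hΦx : (Φ p.1 : EuclideanSpace ℝ (Fin m)) = Φ x := by rw [hXp]
  have e : (mfderiv (𝓡 (m + 2)) (𝓡 m) X (j p) (push j p (k p)) : EuclideanSpace ℝ (Fin m)) =
      Φ x := (mfderiv_X_push hj hB p (k p)).trans ((hΦ p).trans hΦx)
  have h' := h.trans ((htr (X (j p)) (by rw [hB.X_horizon, hXp]) _).trans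
    (congrArg (fun w : EuclideanSpace ℝ (Fin m) =>
      vderiv (𝓡 m) (extChartAt (𝓡 m) x) x w) e))
  exact (vderiv_extChartAt_bijective (mem_extChartAt_source (I := 𝓡 m) x)).1 h'

end BondiKilling

/-! ### Injectivity of the differential of an immersion. -/

section Immersion
variable {E : Type*} [NormedAddCommGroup E] [NormedSpace ℝ E]
  {H : Type*} [TopologicalSpace H] {I : ModelWithCorners ℝ E H} [I.Boundaryless]
  {N : Type*} [TopologicalSpace N] [ChartedSpace H N]
  {E' : Type*} [NormedAddCommGroup E'] [NormedSpace ℝ E']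
  {H' : Type*} [TopologicalSpace H'] {I' : ModelWithCorners ℝ E' H'}
  {N' : Type*} [TopologicalSpace N'] [ChartedSpace H' N']

lemma mfderiv_injective_of_isImmersionAt {f : N → N'} {x : N}
    (h : Manifold.IsImmersionAt I I' ∞ f x) : Function.Injective (mfderiv I I' f x) := by
  have hx := h.mem_domChart_source
  let φ := h.domChart.extend I
  let ψ := h.codChart.extend I'
  have hφx : φ x ∈ φ.target := φ.map_source (by rwa [h.domChart.extend_source])
  have hw : ∀ y ∈ h.domChart.source, ψ (f y) = h.equiv (φ y, 0) := by
    intro y hy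
    have hy' : y ∈ φ.source := by rwa [h.domChart.extend_source]
    have := h.writtenInCharts (φ.map_source hy')
    simp only [Function.comp_apply] at this
    rwa [φ.left_inv hy'] at this
  let L : E' → E := fun z => (h.equiv.symm z).1
  have hLx : L (ψ (f x)) = φ x := by simp only [L, hw x hx, h.equiv.symm_apply_apply]
  have hφt : φ.target ∈ 𝓝 (φ x) := by
    have := h.domChart.extend_target_mem_nhdsWithin (I := I) hx
    rwa [I.range_eq_univ, nhdsWithin_univ] at this
  have d3 : MDifferentiableAt 𝓘(ℝ, E) I φ.symm (L (ψ (f x))) := by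
    rw [hLx]
    have hs := contMDiffOn_extend_symm h.domChart_mem_maximalAtlas
    refine (hs.contMDiffAt ?_).mdifferentiableAt (by simp)
    refine Filter.mem_of_superset hφt fun z hz => ?_
    rw [h.domChart.extend_target] at hz
    exact ⟨I.symm z, hz.1, I.right_inv hz.2⟩
  have d2 : MDifferentiableAt 𝓘(ℝ, E') 𝓘(ℝ, E) L (ψ (f x)) :=
    (((ContinuousLinearMap.fst ℝ E h.complement).comp
      (h.equiv.symm : E' →L[ℝ] E × h.complement)).differentiableAt).mdifferentiableAt
  have d1 : MDifferentiableAt I' 𝓘(ℝ, E') ψ (f x) :=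
    (h.codChart.contMDiffAt_extend h.codChart_mem_maximalAtlas
      h.mem_codChart_source).mdifferentiableAt (by simp)
  have d0 : MDifferentiableAt I I' f x := h.contMDiffAt.mdifferentiableAt (by simp)
  -- A smooth local left inverse: in the adapted charts the immersion is $z\mapsto(z,0)$ up to a
  -- linear isomorphism, and `L` projects back.
  let G : N' → N := φ.symm ∘ (L ∘ ψ)
  have dG : MDifferentiableAt I' I G (f x) := d3.comp (f x) (d2.comp (f x) d1)
  have hid : (G ∘ f) =ᶠ[𝓝 x] id := by
    filter_upwards [h.domChart.open_source.mem_nhds hx] with y hy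
    have hy' : y ∈ φ.source := by rwa [h.domChart.extend_source]
    simp only [G, L, Function.comp_apply, hw y hy, h.equiv.symm_apply_apply, id_eq]
    exact φ.left_inv hy'
  have hmf := mfderiv_comp x dG d0
  rw [injective_iff_map_eq_zero]
  intro w hw0
  have h1 : mfderiv I I (G ∘ f) x w = (0 : E) := by
    rw [hmf]
    change mfderiv I' I G (f x) (mfderiv I I' f x w) = 0
    rw [hw0, map_zero]
  rw [hid.mfderiv_eq, mfderiv_id] at h1
  exact h1

end Immersion

/-! ### Null directions of the horizon and projection to the base. -/

section Null

variable {m : ℕ} {M : Type*} [TopologicalSpace M]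
  [ChartedSpace (EuclideanSpace ℝ (Fin (m + 2))) M] [IsManifold (𝓡 (m + 2)) ∞ M]
  {B : Type*} [TopologicalSpace B] [ChartedSpace (EuclideanSpace ℝ (Fin m)) B]

variable (m) in
/-- The vector tangent to the fibres of `B × ℝ → B`. -/
def vert (p : B × ℝ) : TangentSpace (HModel m) p :=
  ((0, 1) : EuclideanSpace ℝ (Fin m) × ℝ)

lemma baseComp_apply (p : B × ℝ) (w : EuclideanSpace ℝ (Fin m) × ℝ) :
    (baseComp (m := m) p w : EuclideanSpace ℝ (Fin m)) = w.1 := by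
  unfold baseComp
  rw [mfderiv_fst]
  rfl

lemma vert_ne_zero (p : B × ℝ) : vert m p ≠ 0 := fun h =>
  one_ne_zero (congrArg Prod.snd (h : ((0, 1) : EuclideanSpace ℝ (Fin m) × ℝ) = 0))

lemma baseComp_vert (p : B × ℝ) : baseComp p (vert m p) = 0 := baseComp_apply p _

lemma baseComp_smul (p : B × ℝ) (c : ℝ) (w : TangentSpace (HModel m) p) :
    baseComp p (c • w) = c • baseComp p w :=
  map_smul (mfderiv (HModel m) (𝓡 m) (Prod.fst : B × ℝ → B) p) c w

lemma eq_smul_vert {p : B × ℝ} {w : TangentSpace (HModel m) p} (h : baseComp p w = 0) :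
    ∃ c : ℝ, w = c • vert m p := by
  obtain ⟨w₁, c⟩ : EuclideanSpace ℝ (Fin m) × ℝ := w
  have h1 : w₁ = 0 := (baseComp_apply p (w₁, c)).symm.trans h
  refine ⟨c, ?_⟩
  change ((w₁, c) : EuclideanSpace ℝ (Fin m) × ℝ) =
    c • ((0, 1) : EuclideanSpace ℝ (Fin m) × ℝ)
  simp [h1]

/-- Null vectors are tangent to the fibres. -/
lemma baseComp_eq_zero_of_null [IsManifold (𝓡 m) ∞ B] {g : LorentzMetric m M} {j : B × ℝ → M}
    (hj : IsNonExpandingHorizon g j) {p : B × ℝ} {w : TangentSpace (HModel m) p}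
    (hw : induced g j p w w = 0) : baseComp p w = 0 := by
  have hinj : Function.Injective (push (m := m) j p) :=
    mfderiv_injective_of_isImmersionAt (hj.embedding.isImmersion.isImmersionAt p)
  have hpush0 : push (m := m) j p 0 = 0 := map_zero (mfderiv (HModel m) (𝓡 (m + 2)) j p)
  have hsmul : ∀ (c : ℝ) (u : TangentSpace (HModel m) p), push j p (c • u) = c • push j p u :=
    fun c u => map_smul (mfderiv (HModel m) (𝓡 (m + 2)) j p) c u
  -- Both `w` and the vertical vector are null and orthogonal to the degenerate direction `u`, hence
  -- multiples of it; the vertical one is a nonzero multiple, so `u` is vertical.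
  obtain ⟨u, hu, huu⟩ := hj.null p
  have hu' : push j p u ≠ 0 := fun h => hu (hinj (h.trans hpush0.symm))
  obtain ⟨c, hc⟩ := g.eq_smul_of_null hu' (huu u) (huu w) hw
  obtain ⟨d, hd⟩ := g.eq_smul_of_null hu' (huu u) (huu (vert m p))
    (hj.generators p _ (baseComp_vert p))
  have hd0 : d ≠ 0 := by
    rintro rfl
    rw [zero_smul] at hd
    exact vert_ne_zero p (hinj (hd.trans hpush0.symm))
  rw [← hsmul] at hc hd
  have h1 := hinj hc
  have h2 := hinj hd
  have h3 : baseComp p u = 0 := by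
    have := baseComp_vert (m := m) p
    rw [h2, baseComp_smul] at this
    exact (smul_eq_zero.1 this).resolve_left hd0
  rw [h1, baseComp_smul, h3, smul_zero]

lemma hasMFDerivAt_fibre (x : B) (s : ℝ) :
    HasMFDerivAt 𝓘(ℝ, ℝ) (HModel m) (fun s : ℝ => (x, s)) s
      ((1 : ℝ →L[ℝ] ℝ).smulRight (vert m (x, s))) := by
  have h := (hasMFDerivAt_const (I := 𝓘(ℝ, ℝ)) (I' := 𝓡 m) x s).prodMk
    (hasMFDerivAt_id (I := 𝓘(ℝ, ℝ)) s)
  have : ((0 : ℝ →L[ℝ] EuclideanSpace ℝ (Fin m)).prod (ContinuousLinearMap.id ℝ ℝ)) =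
      (1 : ℝ →L[ℝ] ℝ).smulRight ((0, 1) : EuclideanSpace ℝ (Fin m) × ℝ) := by
    ext1; simp
  exact this ▸ h

lemma isMIntegralCurveOn_fibre (x : B) (S : Set ℝ) :
    IsMIntegralCurveOn (I := HModel m) (fun s : ℝ => (x, s)) (vert m) S :=
  fun s _ => (hasMFDerivAt_fibre x s).hasMFDerivWithinAt

variable [IsManifold (𝓡 m) ∞ B]

/-- A vector field that commutes with a nowhere vanishing vertical field projects to the base. -/
lemma baseComp_eq_of_commute {k ℓ : ∀ p : B × ℝ, TangentSpace (HModel m) p}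
    (hk : ∀ p, SmoothAt (HModel m) k p) (hℓ : ∀ p, SmoothAt (HModel m) ℓ p)
    (hℓv : ∀ p, baseComp p (ℓ p) = 0) (hℓ0 : ∀ p, ℓ p ≠ 0)
    (hℓk : ∀ p, mlieBracket (HModel m) ℓ k p = 0) (x : B) (s t : ℝ) :
    (baseComp (x, s) (k (x, s)) : EuclideanSpace ℝ (Fin m)) = baseComp (x, t) (k (x, t)) := by
  have : IsManifold (𝓡 m) 1 B := IsManifold.of_le (n := ∞) (by simp)
  let f : B × ℝ → EuclideanSpace ℝ (Fin m) := fun q => extChartAt (𝓡 m) x q.1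
  let D : Set (B × ℝ) := Prod.fst ⁻¹' (extChartAt (𝓡 m) x).source
  have hD : IsOpen D := (isOpen_extChartAt_source x).preimage continuous_fst
  have hφ : ∀ q ∈ D, ContMDiffAt (𝓡 m) 𝓘(ℝ, EuclideanSpace ℝ (Fin m)) ∞
      (extChartAt (𝓡 m) x) q.1 := fun q hq =>
    contMDiffAt_extChartAt' (by rw [← extChartAt_source (𝓡 m)]; exact hq)
  have hf : ∀ q ∈ D, ContMDiffAt (HModel m) 𝓘(ℝ, EuclideanSpace ℝ (Fin m)) ∞ f q := fun q hq =>
    (hφ q hq).comp q contMDiffAt_fst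
  have hfd : ∀ q ∈ D, ∀ w : TangentSpace (HModel m) q,
      vderiv (HModel m) f q w = vderiv (𝓡 m) (extChartAt (𝓡 m) x) q.1 (baseComp q w) :=
    fun q hq w => vderiv_comp ((hφ q hq).mdifferentiableAt (by simp)) mdifferentiableAt_fst w
  have hxD : ∀ s, ((x, s) : B × ℝ) ∈ D := fun s => mem_extChartAt_source (I := 𝓡 m) x
  have h := eq_of_vderiv_eq_zero (f := fun q => vderiv (HModel m) f q (k q)) convex_univ
    (isMIntegralCurveOn_fibre (m := m) x univ) (fun s _ => by
      refine ⟨(SmoothAt.contMDiffAt_vderiv (hf _ (hxD s)) (hk _)).mdifferentiableAt (by simp), ?_⟩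
      -- The base coordinates are killed by $\ell$, so by commutation $\ell$ also kills their
      -- derivatives along $k$.
      have h0 : vderiv (HModel m) (fun q => vderiv (HModel m) f q (k q)) (x, s) (ℓ (x, s)) = 0 := by
        refine vderiv_vderiv_eq_zero (c := 0) (hf _ (hxD s)) (hk _) (hℓ _) ?_ ?_
        · rw [mlieBracket_swap_apply, hℓk, neg_zero]
        · filter_upwards [hD.mem_nhds (hxD s)] with q hq
          rw [hfd q hq, hℓv, vderiv_zero]
      obtain ⟨c, hc⟩ := eq_smul_vert (hℓv (x, s))
      rw [hc, vderiv_smul] at h0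
      refine (smul_eq_zero.1 h0).resolve_left ?_
      rintro rfl
      exact hℓ0 (x, s) (by rw [hc, zero_smul])) (mem_univ t) (mem_univ s)
  rw [hfd _ (hxD s), hfd _ (hxD t)] at h
  exact (vderiv_extChartAt_bijective (mem_extChartAt_source (I := 𝓡 m) x)).1 h

lemma smoothAt_baseComp {k : ∀ p : B × ℝ, TangentSpace (HModel m) p}
    (hk : ∀ p, SmoothAt (HModel m) k p) (s : ℝ) (x : B) :
    SmoothAt (𝓡 m) (fun x => baseComp (x, s) (k (x, s))) x := by
  have h1 := SmoothAt.contMDiffAt_mfderiv (I' := 𝓡 m) (f := (Prod.fst : B × ℝ → B))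
    contMDiffAt_fst (hk (x, s))
  have h2 : ContMDiffAt (𝓡 m) (HModel m) ∞ (fun x : B => (x, s)) x :=
    contMDiffAt_id.prodMk contMDiffAt_const
  exact h1.comp x h2

end Null

/-! ### Foliations by sections and the height function. -/

section Foliation

variable {m : ℕ} {B : Type*} [TopologicalSpace B] [ChartedSpace (EuclideanSpace ℝ (Fin m)) B]

/-- The differential is block triangular with the vertical derivative of `u` on the diagonal. -/
lemma isLocalDiffeomorphAt_prodMk [IsManifold (𝓡 m) ∞ B] {u : B × ℝ → ℝ} {U : Set (B × ℝ)}
    {p : B × ℝ} (hU : U ∈ 𝓝 p) (hu : ContMDiffOn (HModel m) 𝓘(ℝ, ℝ) ∞ u U)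
    (hne : vderiv (HModel m) u p (vert m p) ≠ 0) :
    IsLocalDiffeomorphAt (HModel m) (HModel m) ∞ (fun q : B × ℝ => (q.1, u q)) p := by
  refine isLocalDiffeomorphAt_of_mfderiv hU (contMDiffOn_fst.prodMk hu) ?_
  have hm := mfderiv_prodMk (I := HModel m) (I' := 𝓡 m) (I'' := 𝓘(ℝ, ℝ)) (x := p)
    (f := (Prod.fst : B × ℝ → B)) (g := u) mdifferentiableAt_fst
    ((hu.contMDiffAt hU).mdifferentiableAt (by simp))
  let A : EuclideanSpace ℝ (Fin m) × ℝ →L[ℝ] EuclideanSpace ℝ (Fin m) × ℝ :=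
    mfderiv (HModel m) (HModel m) (fun q : B × ℝ => (q.1, u q)) p
  have hA : ∀ w : TangentSpace (HModel m) p, A w = (baseComp p w, vderiv (HModel m) u p w) := by
    intro w
    change mfderiv (HModel m) (HModel m) (fun q : B × ℝ => (q.1, u q)) p w = _
    rw [hm]
    rfl
  have hinj : Function.Injective A := by
    rw [injective_iff_map_eq_zero]
    intro w hw
    have h := (hA w).symm.trans hw
    obtain ⟨c, hc⟩ := eq_smul_vert (p := p) (w := w) (congrArg Prod.fst h)
    have h2 : vderiv (HModel m) u p w = 0 := congrArg Prod.snd h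
    rw [hc, vderiv_smul] at h2
    have hc0 : c = 0 := (smul_eq_zero.1 h2).resolve_right hne
    rw [hc0] at hc
    exact hc.trans (zero_smul ℝ (vert m p))
  have hsurj : Function.Surjective A := (LinearMap.injective_iff_surjective (f := A.toLinearMap)).1 hinj
  exact ⟨hinj, hsurj⟩

variable {leaf : Setoid (B × ℝ)}

namespace IsFoliationBySections

variable (hleaf : IsFoliationBySections m leaf)
include hleaf

/-- The section of the projection to the base whose image is the leaf through `p`. -/
noncomputable def leafSection (p : B × ℝ) : B → B × ℝ := (hleaf.section_leaf p).choose

/-- The height at which the leaf through `p` meets the fibre over `x`. -/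
noncomputable def height (x : B) (p : B × ℝ) : ℝ := (hleaf.leafSection p x).2

lemma contMDiff_leafSection (p : B × ℝ) :
    ContMDiff (𝓡 m) (HModel m) ∞ (hleaf.leafSection p) :=
  (hleaf.section_leaf p).choose_spec.1

lemma leafSection_fst (p : B × ℝ) (x : B) : (hleaf.leafSection p x).1 = x :=
  (hleaf.section_leaf p).choose_spec.2.1 x

lemma leaf_leafSection (p : B × ℝ) (x : B) : leaf p (hleaf.leafSection p x) := by
  have h : hleaf.leafSection p x ∈ {q | leaf p q} := by
    rw [(hleaf.section_leaf p).choose_spec.2.2]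
    exact ⟨x, rfl⟩
  exact h

lemma leafSection_eq {p q : B × ℝ} (h : leaf p q) : hleaf.leafSection p q.1 = q := by
  have h' : q ∈ {q | leaf p q} := h
  rw [(hleaf.section_leaf p).choose_spec.2.2] at h'
  obtain ⟨x, rfl⟩ := h'
  exact congrArg _ (hleaf.leafSection_fst p x)

/-- A leaf meets each fibre only once. -/
lemma eq_of_leaf {p q : B × ℝ} (h : leaf p q) (h1 : p.1 = q.1) : p = q := by
  rw [← hleaf.leafSection_eq (leaf.refl p), h1, hleaf.leafSection_eq h]

lemma leafSection_congr {p q : B × ℝ} (h : leaf p q) :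
    hleaf.leafSection p = hleaf.leafSection q := by
  funext x
  have h1 := hleaf.leafSection_eq (leaf.trans h (hleaf.leaf_leafSection q x))
  rwa [hleaf.leafSection_fst] at h1

lemma leaf_mk_height (x : B) (p : B × ℝ) : leaf p (x, hleaf.height x p) := by
  have h : hleaf.leafSection p x = (x, hleaf.height x p) :=
    Prod.ext (hleaf.leafSection_fst p x) rfl
  exact h ▸ hleaf.leaf_leafSection p x

lemma height_eq {x : B} {s : ℝ} {p : B × ℝ} (h : leaf p (x, s)) : hleaf.height x p = s :=
  congrArg Prod.snd (hleaf.leafSection_eq h)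

lemma height_mk (x : B) (s : ℝ) : hleaf.height x (x, s) = s := hleaf.height_eq (leaf.refl _)

lemma leaf_iff (x : B) (p q : B × ℝ) : leaf p q ↔ hleaf.height x p = hleaf.height x q := by
  refine ⟨fun h => hleaf.height_eq (leaf.trans h (hleaf.leaf_mk_height x q)), fun h => ?_⟩
  have h1 := hleaf.leaf_mk_height x p
  rw [h] at h1
  exact leaf.trans h1 (leaf.symm (hleaf.leaf_mk_height x q))

/-- The functions that define the foliation locally are not constant along the fibres. -/
lemma vderiv_vert_ne_zero {U : Set (B × ℝ)} {u : B × ℝ → ℝ} (hU : IsOpen U)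
    (hu : ContMDiffOn (HModel m) 𝓘(ℝ, ℝ) ∞ u U)
    (hleaf_u : ∀ q ∈ U, ∀ q' ∈ U, leaf q q' ↔ u q = u q') {q : B × ℝ} (hq : q ∈ U)
    {w : TangentSpace (HModel m) q} (hw : vderiv (HModel m) u q w ≠ 0) :
    vderiv (HModel m) u q (vert m q) ≠ 0 := by
  obtain ⟨σ, hσ, hσ1, hσr⟩ := hleaf.section_leaf q
  obtain ⟨x, hx⟩ : q ∈ range σ := hσr ▸ (leaf.refl q : q ∈ {q' | leaf q q'})
  subst hx
  have hσx : ContMDiffAt (𝓡 m) (HModel m) ∞ σ x := hσ x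
  have d1 := hσx.mdifferentiableAt (by simp)
  have d2 := (hu.contMDiffAt (hU.mem_nhds hq)).mdifferentiableAt (by simp)
  -- Split `w` as the lift of its base part along the section `σ` plus a vertical vector. The lift
  -- is tangent to the leaf, where `u` is constant, so a nonzero derivative can come only from the
  -- vertical part.
  let ξ : TangentSpace (𝓡 m) x := (baseComp (σ x) w : EuclideanSpace ℝ (Fin m))
  have h0 : vderiv (HModel m) u (σ x) (mfderiv (𝓡 m) (HModel m) σ x ξ) = 0 := by
    rw [← vderiv_comp d2 d1, vderiv_congr (f' := fun _ => u (σ x)), vderiv_const]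
    filter_upwards [hσx.continuousAt.eventually_mem (hU.mem_nhds hq)] with y hy
    have : σ y ∈ {q' | leaf (σ x) q'} := hσr ▸ mem_range_self y
    exact ((hleaf_u _ hq _ hy).1 this).symm
  have h1 : (baseComp (σ x) (mfderiv (𝓡 m) (HModel m) σ x ξ) : EuclideanSpace ℝ (Fin m)) = ξ := by
    have h := mfderiv_comp x (g := (Prod.fst : B × ℝ → B)) (I' := HModel m) (I'' := 𝓡 m)
      mdifferentiableAt_fst d1
    have hid : (Prod.fst : B × ℝ → B) ∘ σ = id := funext hσ1
    have hcongr : ∀ f f' : B → B, f = f' → (mfderiv (𝓡 m) (𝓡 m) f x ξ :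
        EuclideanSpace ℝ (Fin m)) = mfderiv (𝓡 m) (𝓡 m) f' x ξ := by
      rintro f _ rfl; rfl
    have h2 := hcongr _ _ hid
    rw [h, mfderiv_id] at h2
    exact h2
  have h3 : baseComp (σ x) (w - mfderiv (𝓡 m) (HModel m) σ x ξ) = 0 := by
    have : baseComp (σ x) (w - mfderiv (𝓡 m) (HModel m) σ x ξ) =
        baseComp (σ x) w - baseComp (σ x) (mfderiv (𝓡 m) (HModel m) σ x ξ) :=
      map_sub (mfderiv (HModel m) (𝓡 m) (Prod.fst : B × ℝ → B) (σ x)) _ _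
    rw [this]
    exact sub_eq_zero.2 h1.symm
  obtain ⟨c, hc⟩ := eq_smul_vert h3
  intro hv
  apply hw
  have h4 : vderiv (HModel m) u (σ x) (w - mfderiv (𝓡 m) (HModel m) σ x ξ) = 0 := by
    rw [hc, vderiv_smul, hv, smul_zero]
  rwa [vderiv_sub, h0, sub_zero] at h4

variable [IsManifold (𝓡 m) ∞ B]

/-- Near a leaf, one can slide along the leaves into a neighbouring fibre. -/
lemma exists_slide (p : B × ℝ) : ∃ W ∈ 𝓝 p.1, ∀ y ∈ W, ∀ y' ∈ W, ∃ T : B × ℝ → B × ℝ,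
    ContMDiffAt (HModel m) (HModel m) ∞ T (hleaf.leafSection p y') ∧
    T (hleaf.leafSection p y') = hleaf.leafSection p y ∧
    ∀ᶠ q in 𝓝 (hleaf.leafSection p y'), leaf q (T q) ∧ (T q).1 = y := by
  obtain ⟨U, u, hU, hpU, hu, hdu, hleaf_u⟩ := hleaf.foliated_chart p
  obtain ⟨w, hw⟩ := hdu p hpU
  obtain ⟨Φ, hpΦ, hΦ⟩ := isLocalDiffeomorphAt_prodMk (hU.mem_nhds hpU) hu
    (hleaf.vderiv_vert_ne_zero hU hu hleaf_u hpU hw)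
  have hσp : hleaf.leafSection p p.1 = p := hleaf.leafSection_eq (leaf.refl p)
  set σ := hleaf.leafSection p with hσ
  have hO : IsOpen (Φ.source ∩ U) := Φ.open_source.inter hU
  have hσc : Continuous σ := (hleaf.contMDiff_leafSection p).continuous
  refine ⟨σ ⁻¹' (Φ.source ∩ U), hσc.continuousAt.preimage_mem_nhds
    (hO.mem_nhds (by rw [hσp]; exact ⟨hpΦ, hpU⟩)), fun y hy y' hy' => ?_⟩
  have huσ : u (σ y') = u (σ y) := (hleaf_u _ hy'.2 _ hy.2).1
    (leaf.trans (leaf.symm (hleaf.leaf_leafSection p y')) (hleaf.leaf_leafSection p y))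
  have hG : Φ.toPartialEquiv (σ y) = (y, u (σ y')) := by
    refine (hΦ hy.1).symm.trans ?_
    rw [huσ]
    exact Prod.ext (hleaf.leafSection_fst p y) rfl
  have hmem : (y, u (σ y')) ∈ Φ.target := hG ▸ Φ.map_source hy.1
  have hinv : Φ.toPartialEquiv.symm (y, u (σ y')) = σ y := by rw [← hG]; exact Φ.left_inv hy.1
  have hu' : ContMDiffAt (HModel m) 𝓘(ℝ, ℝ) ∞ u (σ y') := hu.contMDiffAt (hU.mem_nhds hy'.2)
  have hyu : ContMDiffAt (HModel m) (HModel m) ∞ (fun q => (y, u q)) (σ y') :=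
    contMDiffAt_const.prodMk hu'
  have hsymm : ContMDiffAt (HModel m) (HModel m) ∞ Φ.toPartialEquiv.symm (y, u (σ y')) :=
    Φ.contMDiffOn_invFun.contMDiffAt (Φ.open_target.mem_nhds hmem)
  have hT : ContMDiffAt (HModel m) (HModel m) ∞
      (fun q => Φ.toPartialEquiv.symm (y, u q)) (σ y') :=
    ContMDiffAt.comp (σ y') hsymm hyu
  -- In the chart $(\pi,u)$ the leaves are horizontal, so sliding to the fibre over `y` keeps `u`
  -- and replaces the base point.
  refine ⟨fun q => Φ.toPartialEquiv.symm (y, u q), hT, hinv, ?_⟩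
  have e1 := hT.continuousAt.eventually_mem (hU.mem_nhds (by rw [hinv]; exact hy.2))
  have e2 := hyu.continuousAt.eventually_mem (Φ.open_target.mem_nhds hmem)
  filter_upwards [e1, e2, hU.mem_nhds hy'.2] with q hq1 hq2 hqU
  have h1 : Φ.toPartialEquiv (Φ.toPartialEquiv.symm (y, u q)) = (y, u q) := Φ.right_inv hq2
  have h2 := (hΦ (Φ.map_target hq2)).trans h1
  exact ⟨(hleaf_u _ hqU _ hq1).2 (congrArg Prod.snd h2).symm, congrArg Prod.fst h2⟩

/-- Near its own fibre the height is the second component of a slide into that fibre. -/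
lemma contMDiffAt_height_fibre (x : B) (s : ℝ) :
    ContMDiffAt (HModel m) 𝓘(ℝ, ℝ) ∞ (hleaf.height x) (x, s) := by
  obtain ⟨W, hW, h⟩ := hleaf.exists_slide (x, s)
  obtain ⟨T, hT, -, hTe⟩ := h x (mem_of_mem_nhds hW) x (mem_of_mem_nhds hW)
  have hσ : hleaf.leafSection (x, s) x = (x, s) := hleaf.leafSection_eq (leaf.refl (x, s))
  rw [hσ] at hT hTe
  refine (contMDiffAt_snd.comp (x, s) hT).congr_of_eventuallyEq ?_
  filter_upwards [hTe] with q hq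
  refine hleaf.height_eq ?_
  have : (x, (T q).2) = T q := Prod.ext hq.2.symm rfl
  exact this ▸ hq.1

/-- The height is constant on leaves, so it is unchanged by composing with a slide, and smoothness
travels along a leaf. -/
lemma contMDiffAt_height_slide {x y y' : B} {p : B × ℝ} {T : B × ℝ → B × ℝ}
    (hT : ContMDiffAt (HModel m) (HModel m) ∞ T (hleaf.leafSection p y'))
    (hTy : T (hleaf.leafSection p y') = hleaf.leafSection p y)
    (hTe : ∀ᶠ q in 𝓝 (hleaf.leafSection p y'), leaf q (T q) ∧ (T q).1 = y)
    (h : ContMDiffAt (HModel m) 𝓘(ℝ, ℝ) ∞ (hleaf.height x) (hleaf.leafSection p y)) :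
    ContMDiffAt (HModel m) 𝓘(ℝ, ℝ) ∞ (hleaf.height x) (hleaf.leafSection p y') := by
  rw [← hTy] at h
  refine (h.comp _ hT).congr_of_eventuallyEq ?_
  filter_upwards [hTe] with q hq using (hleaf.leaf_iff x _ _).1 hq.1

lemma contMDiff_height [PreconnectedSpace B] (x : B) :
    ContMDiff (HModel m) 𝓘(ℝ, ℝ) ∞ (hleaf.height x) := by
  intro p
  -- Over the connected base, smoothness along the leaf through `p` is an open and closed condition,
  -- and it holds over `x`.
  let S : Set B := {y | ContMDiffAt (HModel m) 𝓘(ℝ, ℝ) ∞ (hleaf.height x) (hleaf.leafSection p y)}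
  have key : ∀ y, ∃ W ∈ 𝓝 y, ∀ z ∈ W, (z ∈ S ↔ y ∈ S) := by
    intro y
    obtain ⟨W, hW, h⟩ := hleaf.exists_slide (hleaf.leafSection p y)
    rw [hleaf.leafSection_fst] at hW
    rw [← hleaf.leafSection_congr (hleaf.leaf_leafSection p y)] at h
    have hy := mem_of_mem_nhds hW
    refine ⟨W, hW, fun z hz => ⟨fun hzS => ?_, fun hyS => ?_⟩⟩
    · obtain ⟨T, h1, h2, h3⟩ := h z hz y hy
      exact hleaf.contMDiffAt_height_slide h1 h2 h3 hzS
    · obtain ⟨T, h1, h2, h3⟩ := h y hy z hz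
      exact hleaf.contMDiffAt_height_slide h1 h2 h3 hyS
  have hclopen : IsClopen S := by
    constructor
    · rw [← isOpen_compl_iff, isOpen_iff_mem_nhds]
      intro y hy
      obtain ⟨W, hW, h⟩ := key y
      exact Filter.mem_of_superset hW fun z hz hzS => hy ((h z hz).1 hzS)
    · rw [isOpen_iff_mem_nhds]
      intro y hy
      obtain ⟨W, hW, h⟩ := key y
      exact Filter.mem_of_superset hW fun z hz => (h z hz).2 hy
  have hx : x ∈ S := by
    have : hleaf.leafSection p x = (x, hleaf.height x p) :=
      Prod.ext (hleaf.leafSection_fst p x) rfl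
    change ContMDiffAt _ _ _ _ (hleaf.leafSection p x)
    rw [this]
    exact hleaf.contMDiffAt_height_fibre x _
  have hp : p.1 ∈ S := by rw [hclopen.eq_univ ⟨x, hx⟩]; exact mem_univ _
  have hσp : hleaf.leafSection p p.1 = p := hleaf.leafSection_eq (leaf.refl p)
  exact hσp ▸ (hp : ContMDiffAt _ _ _ _ (hleaf.leafSection p p.1))

/-- The maps along leaves between two fibres are smooth and inverse to each other, so their
derivatives multiply to one. -/
lemma vderiv_height_vert_ne_zero [PreconnectedSpace B] (x : B) (p : B × ℝ) :
    vderiv (HModel m) (hleaf.height x) p (vert m p) ≠ 0 := by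
  obtain ⟨y, s⟩ := p
  have h1 := hasDerivAt_comp_curve (((hleaf.contMDiff_height x) (y, s)).mdifferentiableAt (by simp))
    (hasMFDerivAt_fibre (m := m) y s)
  have h2 := hasDerivAt_comp_curve (((hleaf.contMDiff_height y)
    (x, hleaf.height x (y, s))).mdifferentiableAt (by simp))
    (hasMFDerivAt_fibre (m := m) x (hleaf.height x (y, s)))
  have h3 := HasDerivAt.comp s h2 h1
  have h4 : ((fun t => hleaf.height y (x, t)) ∘ fun t => hleaf.height x (y, t)) = id := by
    funext t
    exact hleaf.height_eq (leaf.symm (hleaf.leaf_mk_height x (y, t)))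
  rw [h4] at h3
  have h5 := h3.unique (hasDerivAt_id s)
  exact right_ne_zero_of_mul (h5 ▸ one_ne_zero)

end IsFoliationBySections

end Foliation

/-! ### The action on the space of leaves and the dichotomy for its speed. -/

section Dynamics

variable {m : ℕ} {B : Type*} [TopologicalSpace B] [ChartedSpace (EuclideanSpace ℝ (Fin m)) B]
  [IsManifold (𝓡 m) ∞ B]

lemma exists_isMIntegralCurveAt {k : ∀ p : B × ℝ, TangentSpace (HModel m) p}
    (hk : ∀ p, SmoothAt (HModel m) k p) (p : B × ℝ) :
    ∃ γ : ℝ → B × ℝ, γ 0 = p ∧ IsMIntegralCurveAt γ k 0 := by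
  have : IsManifold (𝓡 m) 1 B := IsManifold.of_le (n := ∞) (by simp)
  exact exists_isMIntegralCurveAt_of_contMDiffAt_boundaryless (I := HModel m) 0
    (ContMDiffAt.of_le (n := ∞) (hk p) (by simp))

lemma vderiv_comp_real {f : ℝ → ℝ} {u : B × ℝ → ℝ} {p : B × ℝ}
    (hf : DifferentiableAt ℝ f (u p)) (hu : MDifferentiableAt (HModel m) 𝓘(ℝ, ℝ) u p)
    (w : TangentSpace (HModel m) p) :
    vderiv (HModel m) (fun q => f (u q)) p w = deriv f (u p) * vderiv (HModel m) u p w := by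
  rw [vderiv_comp (I' := 𝓘(ℝ, ℝ)) hf.mdifferentiableAt hu]
  have : ∀ c : ℝ, vderiv 𝓘(ℝ, ℝ) f (u p) c = deriv f (u p) * c := by
    intro c
    unfold vderiv
    rw [mfderiv_eq_fderiv]
    change fderiv ℝ f (u p) c = _
    rw [fderiv_eq_smul_deriv, smul_eq_mul, mul_comm]
  exact this _

variable {leaf : Setoid (B × ℝ)} {k ℓ : ∀ p : B × ℝ, TangentSpace (HModel m) p}

/-- A field that preserves the foliation acts on the space of leaves. -/
lemma vderiv_eq_of_preserved (hk : ∀ p, SmoothAt (HModel m) k p)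
    (hpres : PreservedByFlow leaf k) {u : B × ℝ → ℝ} (hu : ContMDiff (HModel m) 𝓘(ℝ, ℝ) ∞ u)
    (hleaf_u : ∀ p q, leaf p q ↔ u p = u q) {p q : B × ℝ} (hpq : u p = u q) :
    vderiv (HModel m) u p (k p) = vderiv (HModel m) u q (k q) := by
  obtain ⟨γ, rfl, hγ⟩ := exists_isMIntegralCurveAt hk p
  obtain ⟨γ', rfl, hγ'⟩ := exists_isMIntegralCurveAt hk q
  have h := hasDerivAt_comp_curve ((hu (γ 0)).mdifferentiableAt (by simp)) hγ.hasMFDerivAt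
  have h' := hasDerivAt_comp_curve ((hu (γ' 0)).mdifferentiableAt (by simp)) hγ'.hasMFDerivAt
  obtain ⟨ε, hε, hγε⟩ := isMIntegralCurveAt_iff'.1 hγ
  obtain ⟨ε', hε', hγε'⟩ := isMIntegralCurveAt_iff'.1 hγ'
  refine (h.congr_of_eventuallyEq ?_).unique h' |>.symm ▸ rfl
  have hsub : ∀ {δ : ℝ} (_ : 0 < δ) {t : ℝ}, t ∈ Metric.ball (0 : ℝ) δ →
      uIcc 0 t ⊆ Metric.ball 0 δ := fun hδ t ht =>
    (convex_ball (0 : ℝ) _).ordConnected.uIcc_subset (Metric.mem_ball_self hδ) ht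
  filter_upwards [Metric.ball_mem_nhds (0 : ℝ) hε, Metric.ball_mem_nhds (0 : ℝ) hε'] with t ht ht'
  exact ((hleaf_u _ _).1 (hpres γ γ' t (hγε.mono (hsub hε ht)) (hγε'.mono (hsub hε' ht'))
    ((hleaf_u _ _).2 hpq))).symm

variable {u : B × ℝ → ℝ} {f : ℝ → ℝ}

/-- The function `(k u / ℓ u)² exp (-N u)` has no local maximum at which `k u` does not vanish. -/
lemma vderiv_eq_zero_of_isLocalMax (hk : ∀ p, SmoothAt (HModel m) k p)
    (hℓ : ∀ p, SmoothAt (HModel m) ℓ p) (hℓk : ∀ p, mlieBracket (HModel m) ℓ k p = 0)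
    (hu : ContMDiff (HModel m) 𝓘(ℝ, ℝ) ∞ u) (hf : Differentiable ℝ f)
    (hfu : ∀ p, vderiv (HModel m) u p (k p) = f (u p))
    (hℓu : ∀ p, vderiv (HModel m) u p (ℓ p) ≠ 0) {N : ℝ} (hN : N ≠ 0) {p : B × ℝ}
    (hp : IsLocalMax (fun q => (f (u q) / vderiv (HModel m) u q (ℓ q)) ^ 2
      * Real.exp (-(N * u q))) p) : f (u p) = 0 := by
  have hdu := (hu p).mdifferentiableAt (by simp)
  have hL : MDifferentiableAt (HModel m) 𝓘(ℝ, ℝ) (fun q => vderiv (HModel m) u q (ℓ q)) p :=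
    (SmoothAt.contMDiffAt_vderiv (hu p) (hℓ p)).mdifferentiableAt (by simp)
  -- Commutation of $k$ with $\ell$: $k(\ell u)=\ell(ku)=\ell(f(u))$.
  have hkL : vderiv (HModel m) (fun q => vderiv (HModel m) u q (ℓ q)) p (k p) =
      deriv f (u p) * vderiv (HModel m) u p (ℓ p) := by
    have h := vderiv_mlieBracket (hu p) (hℓ p) (hk p)
    have hA : (fun q => vderiv (HModel m) u q (k q)) = fun q => f (u q) := funext hfu
    rw [hℓk, vderiv_zero, hA, vderiv_comp_real (hf _) hdu] at h
    linarith
  obtain ⟨γ, rfl, hγ⟩ := exists_isMIntegralCurveAt hk p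
  have h1 := hasDerivAt_comp_curve hdu hγ.hasMFDerivAt
  have h2 := hasDerivAt_comp_curve hL hγ.hasMFDerivAt
  rw [hkL] at h2
  rw [hfu] at h1
  have h3 : HasDerivAt (fun t => f (u (γ t))) (deriv f (u (γ 0)) * f (u (γ 0))) 0 :=
    HasDerivAt.comp (h₂ := f) 0 (hf (u (γ 0))).hasDerivAt h1
  have h4 := ((h3.div h2 (hℓu _)).pow 2).mul ((h1.const_mul N).neg.exp)
  have hmax : IsLocalMax (fun t => (f (u (γ t)) / vderiv (HModel m) u (γ t) (ℓ (γ t))) ^ 2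
      * Real.exp (-(N * u (γ t)))) 0 := hγ.continuousAt.eventually hp
  have h5 := hmax.hasDerivAt_eq_zero h4
  have hL0 := hℓu (γ 0)
  -- The quotient $f(u)/\ell u$ has zero derivative along $k$; only the exponential factor
  -- contributes.
  have hz : deriv f (u (γ 0)) * f (u (γ 0)) * vderiv (HModel m) u (γ 0) (ℓ (γ 0)) -
      f (u (γ 0)) * (deriv f (u (γ 0)) * vderiv (HModel m) u (γ 0) (ℓ (γ 0))) = 0 := by ring
  simp only [hz, zero_div, mul_zero, zero_mul, zero_add] at h5
  by_contra hne
  have : (f (u (γ 0)) / vderiv (HModel m) u (γ 0) (ℓ (γ 0))) ^ 2 *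
      (Real.exp (-(N * u (γ 0))) * -(N * f (u (γ 0)))) ≠ 0 :=
    mul_ne_zero (pow_ne_zero 2 (div_ne_zero hne hL0))
      (mul_ne_zero (Real.exp_ne_zero _) (neg_ne_zero.2 (mul_ne_zero hN hne)))
  exact this h5

/-- Either `k` is tangent to all the leaves, or it is transversal to all of them. -/
lemma eq_zero_of_eq_zero (hk : ∀ p, SmoothAt (HModel m) k p)
    (hℓ : ∀ p, SmoothAt (HModel m) ℓ p) (hℓk : ∀ p, mlieBracket (HModel m) ℓ k p = 0)
    (hu : ContMDiff (HModel m) 𝓘(ℝ, ℝ) ∞ u) (hf : Differentiable ℝ f)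
    (hfu : ∀ p, vderiv (HModel m) u p (k p) = f (u p))
    (hℓu : ∀ p, vderiv (HModel m) u p (ℓ p) ≠ 0)
    (hcomp : ∀ c d : ℝ, IsCompact (u ⁻¹' uIcc c d)) (hsurj : Function.Surjective u)
    {c d : ℝ} (hc : f c = 0) : f d = 0 := by
  by_contra hd
  have hcd : d ≠ c := fun h => hd (h ▸ hc)
  -- A comparison level strictly away from `d`, so that the exponential weight can separate the two;
  -- moving slightly from `d` towards `c` keeps `f` nonzero.
  obtain ⟨e, he, hed, hfe⟩ : ∃ e ∈ uIcc c d, e ≠ d ∧ f e ≠ 0 := by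
    have h1 : Filter.Tendsto (fun t : ℝ => d + t * (c - d)) (𝓝 0) (𝓝 d) := by
      have : Continuous fun t : ℝ => d + t * (c - d) := by fun_prop
      simpa using this.tendsto 0
    have h2 : ∀ᶠ t : ℝ in 𝓝[>] 0, f (d + t * (c - d)) ≠ 0 :=
      nhdsWithin_le_nhds (h1.eventually ((hf.continuous.continuousAt).eventually_ne hd))
    obtain ⟨t, ⟨ht, ht0, ht1⟩⟩ :=
      (h2.and (Ioo_mem_nhdsGT (show (0 : ℝ) < 1 by norm_num))).exists
    refine ⟨_, ?_, ?_, ht⟩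
    · rw [uIcc_comm, ← segment_eq_uIcc]
      refine ⟨1 - t, t, by linarith, ht0.le, by ring, ?_⟩
      simp only [smul_eq_mul]; ring
    · intro h
      have : t * (c - d) = 0 := by linarith
      rcases mul_eq_zero.1 this with h | h
      · exact ht0.ne' h
      · exact hcd (by linarith)
  let ν : B × ℝ → ℝ := fun q => (f (u q) / vderiv (HModel m) u q (ℓ q)) ^ 2
  have hνc : Continuous ν := by
    have hL : Continuous fun q => vderiv (HModel m) u q (ℓ q) :=
      continuous_iff_continuousAt.2 fun q =>
        (SmoothAt.contMDiffAt_vderiv (hu q) (hℓ q)).continuousAt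
    exact ((hf.continuous.comp hu.continuous).div hL hℓu).pow 2
  obtain ⟨C, hC⟩ := (hcomp c d).exists_bound_of_continuousOn hνc.continuousOn
  obtain ⟨pe, rfl⟩ := hsurj e
  have hνe : 0 < ν pe := by positivity [hℓu pe]
  obtain ⟨T, hT0, hT⟩ : ∃ T : ℝ, 0 < T ∧ C < ν pe * Real.exp T := by
    have h := (Real.tendsto_exp_atTop.const_mul_atTop hνe).eventually_gt_atTop C
    obtain ⟨T, hT, hT0⟩ := (h.and (Filter.eventually_gt_atTop 0)).exists
    exact ⟨T, hT0, hT⟩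
  have hde : d - u pe ≠ 0 := sub_ne_zero.2 hed.symm
  -- With this sign the weight decreases from the level of `pe` towards `d`, on whichever side `d`
  -- lies, and by the factor $e^{-T}$; this beats the bound `C` of `ν` on the slab.
  set N := T / (d - u pe) with hNdef
  have hN : N ≠ 0 := div_ne_zero hT0.ne' hde
  have hNT : N * (d - u pe) = T := div_mul_cancel₀ _ hde
  let F : B × ℝ → ℝ := fun q => ν q * Real.exp (-(N * u q))
  have hFc : Continuous F := hνc.mul (Real.continuous_exp.comp (hu.continuous.const_mul N).neg)
  obtain ⟨q, hq, hqmax⟩ := (hcomp c d).exists_isMaxOn ⟨pe, he⟩ hFc.continuousOn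
  have hFpe : 0 < F pe := mul_pos hνe (Real.exp_pos _)
  have hFq : F pe ≤ F q := hqmax he
  have hfq : f (u q) ≠ 0 := by
    intro h
    have : F q = 0 := by simp [F, ν, h]
    linarith
  have hqc : u q ≠ c := fun h => hfq (h ▸ hc)
  have hqd : u q ≠ d := by
    intro h
    have h1 : ν q ≤ C := (le_abs_self _).trans (hC q hq)
    have h2 : F q ≤ C * Real.exp (-(N * d)) := by
      simp only [F, h]
      exact mul_le_mul_of_nonneg_right h1 (Real.exp_pos _).le
    have h3 : F pe = ν pe * Real.exp T * Real.exp (-(N * d)) := by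
      simp only [F]
      rw [mul_assoc, ← Real.exp_add, ← hNT]
      ring_nf
    have h4 := mul_lt_mul_of_pos_right hT (Real.exp_pos (-(N * d)))
    linarith
  -- The maximum lies on neither boundary level, so it is a local maximum in the whole horizon.
  have hnhds : uIcc c d ∈ 𝓝 (u q) := by
    have hq' : min c d ≤ u q ∧ u q ≤ max c d := hq
    refine Icc_mem_nhds (lt_of_le_of_ne hq'.1 fun h => ?_) (lt_of_le_of_ne hq'.2 fun h => ?_)
    · rcases min_choice c d with h' | h' <;> rw [h'] at h
      exacts [hqc h.symm, hqd h.symm]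
    · rcases max_choice c d with h' | h' <;> rw [h'] at h
      exacts [hqc h, hqd h]
  have hloc : IsLocalMax F q := hqmax.isLocalMax (hu.continuous.continuousAt.preimage_mem_nhds hnhds)
  exact hfq (vderiv_eq_zero_of_isLocalMax hk hℓ hℓk hu hf hfu hℓu hN hloc)

/-- A function on the line that is identically zero or nowhere zero can be normalized to a
constant by a change of coordinate. -/
lemma exists_reparametrization (hf : ContDiff ℝ ∞ f) (h : ∀ c d, f c = 0 → f d = 0) :
    ∃ (P P' : ℝ → ℝ) (a : ℝ), ContDiff ℝ ∞ P ∧ (∀ c, HasDerivAt P (P' c) c) ∧ (∀ c, P' c ≠ 0) ∧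
      Function.Injective P ∧ ∀ c, P' c * f c = a := by
  by_cases h0 : f 0 = 0
  -- Here `f` vanishes identically, so any coordinate works with speed 0; otherwise $P=\int 1/f$
  -- gives speed 1.
  · exact ⟨id, fun _ => 1, 0, contDiff_id, fun c => hasDerivAt_id c, fun _ => one_ne_zero,
      Function.injective_id, fun c => by rw [h 0 c h0, mul_zero]⟩
  have hne : ∀ c, f c ≠ 0 := fun c hc => h0 (h c 0 hc)
  have hinv : ContDiff ℝ ∞ fun t => (f t)⁻¹ := hf.inv hne
  have hd : ∀ c, HasDerivAt (fun c => ∫ t in (0 : ℝ)..c, (f t)⁻¹) (f c)⁻¹ c := fun c =>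
    (hinv.continuous.integral_hasStrictDerivAt 0 c).hasDerivAt
  refine ⟨fun c => ∫ t in (0 : ℝ)..c, (f t)⁻¹, fun c => (f c)⁻¹, 1, ?_, hd,
    fun c => inv_ne_zero (hne c), ?_, fun c => inv_mul_cancel₀ (hne c)⟩
  · rw [contDiff_infty_iff_deriv]
    refine ⟨fun c => (hd c).differentiableAt, ?_⟩
    have : deriv (fun c => ∫ t in (0 : ℝ)..c, (f t)⁻¹) = fun c => (f c)⁻¹ :=
      funext fun c => (hd c).deriv
    rwa [this]
  · intro c d hcd
    -- By Rolle, two equal values would force a zero of the nowhere vanishing derivative.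
    by_contra hne'
    rcases lt_or_gt_of_ne hne' with hlt | hlt
    · obtain ⟨t, -, ht⟩ := exists_hasDerivAt_eq_zero hlt
        (fun x _ => (hd x).continuousAt.continuousWithinAt) hcd fun x _ => hd x
      exact inv_ne_zero (hne t) ht
    · obtain ⟨t, -, ht⟩ := exists_hasDerivAt_eq_zero hlt
        (fun x _ => (hd x).continuousAt.continuousWithinAt) hcd.symm fun x _ => hd x
      exact inv_ne_zero (hne t) ht

end Dynamics

/-! ### The coordinate adapted to the foliation and to the field. -/

section Adapted

variable {m : ℕ} {B : Type*} [TopologicalSpace B] [ChartedSpace (EuclideanSpace ℝ (Fin m)) B]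
  [IsManifold (𝓡 m) ∞ B] {leaf : Setoid (B × ℝ)}

/-- The map $(\pi,u)$ is a homeomorphism of $B\times\mathbb R$ that carries the preimage to $B\times
S$. Surjectivity holds because every leaf meets every fibre. -/
lemma isCompact_preimage_height [PreconnectedSpace B] [CompactSpace B]
    (hleaf : IsFoliationBySections m leaf) (x : B) {S : Set ℝ} (hS : IsCompact S) :
    IsCompact (hleaf.height x ⁻¹' S) := by
  have hsmooth := hleaf.contMDiff_height x
  have hdiff : IsLocalDiffeomorph (HModel m) (HModel m) ∞
      (fun q : B × ℝ => (q.1, hleaf.height x q)) := fun q =>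
    isLocalDiffeomorphAt_prodMk Filter.univ_mem hsmooth.contMDiffOn
      (hleaf.vderiv_height_vert_ne_zero x q)
  have hcont : Continuous (fun q : B × ℝ => (q.1, hleaf.height x q)) :=
    continuous_fst.prodMk hsmooth.continuous
  have hinj : Function.Injective (fun q : B × ℝ => (q.1, hleaf.height x q)) := by
    intro p q hpq
    obtain ⟨h1, h2⟩ := Prod.mk.inj hpq
    exact hleaf.eq_of_leaf ((hleaf.leaf_iff x p q).2 h2) h1
  have hsurj : Function.Surjective (fun q : B × ℝ => (q.1, hleaf.height x q)) := by
    rintro ⟨y, c⟩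
    exact ⟨(y, hleaf.height y (x, c)),
      Prod.ext rfl (hleaf.height_eq (leaf.symm (hleaf.leaf_mk_height y (x, c))))⟩
  have hhomeo : IsHomeomorph (fun q : B × ℝ => (q.1, hleaf.height x q)) :=
    ⟨hcont, hdiff.isOpenMap, hinj, hsurj⟩
  have h := hhomeo.isClosedEmbedding.isCompact_preimage (isCompact_univ.prod hS)
  have he : (fun q : B × ℝ => (q.1, hleaf.height x q)) ⁻¹' (univ ×ˢ S) =
      hleaf.height x ⁻¹' S := by
    ext q
    simp
  rwa [he] at h

/-- There is a coordinate along the fibres that is constant on the leaves and along which `k` has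
constant speed. -/
lemma exists_adapted_coordinate [ConnectedSpace B] [CompactSpace B]
    (hleaf : IsFoliationBySections m leaf) {k ℓ : ∀ p : B × ℝ, TangentSpace (HModel m) p}
    (hk : ∀ p, SmoothAt (HModel m) k p) (hℓ : ∀ p, SmoothAt (HModel m) ℓ p)
    (hℓv : ∀ p, baseComp p (ℓ p) = 0) (hℓ0 : ∀ p, ℓ p ≠ 0)
    (hℓk : ∀ p, mlieBracket (HModel m) ℓ k p = 0) (hpres : PreservedByFlow leaf k) :
    ∃ (v : B × ℝ → ℝ) (a : ℝ), IsHorizonCoordinate m v ∧ (∀ p q, leaf p q ↔ v p = v q) ∧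
      ∀ p, vderiv (HModel m) v p (k p) = a := by
  obtain ⟨x⟩ : Nonempty B := inferInstance
  set u := hleaf.height x with hu_def
  have hu : ContMDiff (HModel m) 𝓘(ℝ, ℝ) ∞ u := hleaf.contMDiff_height x
  have huv : ∀ p, vderiv (HModel m) u p (vert m p) ≠ 0 := hleaf.vderiv_height_vert_ne_zero x
  have hℓu : ∀ p, vderiv (HModel m) u p (ℓ p) ≠ 0 := by
    intro p
    obtain ⟨c, hc⟩ := eq_smul_vert (hℓv p)
    have hc0 : c ≠ 0 := by
      rintro rfl
      exact hℓ0 p (hc.trans (zero_smul ℝ (vert m p)))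
    rw [hc, vderiv_smul]
    exact smul_ne_zero hc0 (huv p)
  let f : ℝ → ℝ := fun c => vderiv (HModel m) u (x, c) (k (x, c))
  have hf : ContDiff ℝ ∞ f := by
    rw [← contMDiff_iff_contDiff]
    intro c
    exact ContMDiffAt.comp (I' := HModel m) (g := fun p => vderiv (HModel m) u p (k p)) c
      (SmoothAt.contMDiffAt_vderiv (hu (x, c)) (hk (x, c)))
      (contMDiffAt_const.prodMk contMDiffAt_id)
  -- The point `(x, u p)` lies on the leaf through `p`, and `k u` is constant on leaves.
  have hfu : ∀ p, vderiv (HModel m) u p (k p) = f (u p) := fun p =>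
    vderiv_eq_of_preserved hk hpres hu (hleaf.leaf_iff x) (hleaf.height_mk x (u p)).symm
  obtain ⟨P, P', a, hP, hPd, hP0, hPinj, hPf⟩ := exists_reparametrization hf fun c d hc =>
    eq_zero_of_eq_zero hk hℓ hℓk hu (hf.differentiable (by simp)) hfu hℓu
      (fun c d => isCompact_preimage_height hleaf x isCompact_uIcc)
      (fun c => ⟨(x, c), hleaf.height_mk x c⟩) hc
  have hvd : ∀ p w, vderiv (HModel m) (fun q => P (u q)) p w =
      P' (u p) * vderiv (HModel m) u p w := by
    intro p w
    rw [vderiv_comp_real (hPd _).differentiableAt ((hu p).mdifferentiableAt (by simp)),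
      (hPd _).deriv]
  have hv : ContMDiff (HModel m) 𝓘(ℝ, ℝ) ∞ fun q => P (u q) := hP.contMDiff.comp hu
  have hlv : ∀ p q, leaf p q ↔ P (u p) = P (u q) := fun p q =>
    (hleaf.leaf_iff x p q).trans hPinj.eq_iff.symm
  refine ⟨fun q => P (u q), a, ⟨hv, ?_, ?_⟩, hlv, ?_⟩
  · intro p q hpq
    obtain ⟨h1, h2⟩ := Prod.mk.inj hpq
    exact hleaf.eq_of_leaf ((hlv p q).2 h2) h1
  · intro p
    refine isLocalDiffeomorphAt_prodMk Filter.univ_mem hv.contMDiffOn ?_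
    rw [hvd]
    exact mul_ne_zero (hP0 _) (huv p)
  · intro p
    rw [hvd, hfu, hPf]

end Adapted

end Horizon

theorem mainTheorem4 {m : ℕ}
    {M : Type*} [TopologicalSpace M] [T2Space M] [SecondCountableTopology M]
    [ChartedSpace (EuclideanSpace ℝ (Fin (m + 2))) M] [IsManifold (𝓡 (m + 2)) ∞ M]
    {B : Type*} [TopologicalSpace B] [T2Space B] [CompactSpace B] [ConnectedSpace B]
    [ChartedSpace (EuclideanSpace ℝ (Fin m)) B] [IsManifold (𝓡 m) ∞ B]
    (g : Horizon.LorentzMetric m M) (j : B × ℝ → M)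
    (hj : Horizon.IsNonExpandingHorizon g j)
    (K : ∀ x : M, TangentSpace (𝓡 (m + 2)) x) (hK : Horizon.IsKilling g K)
    (k : ∀ p : B × ℝ, TangentSpace (Horizon.HModel m) p)
    (hk : Horizon.IsRestriction j K k)
    (ℓ : ∀ p : B × ℝ, TangentSpace (Horizon.HModel m) p)
    (hℓ_smooth : ∀ p, Horizon.SmoothAt (Horizon.HModel m) ℓ p)
    (hℓ_null : Horizon.IsNullField g j ℓ) (hℓ_ne : ∀ p, ℓ p ≠ 0)
    (hℓk : ∀ p, mlieBracket (Horizon.HModel m) ℓ k p = 0)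
    (leaf : Setoid (B × ℝ)) (hleaf : Horizon.IsFoliationBySections m leaf)
    (hpres : Horizon.PreservedByFlow leaf k) :
    ∃ (v : B × ℝ → ℝ) (a b : ℝ) (Φ : ∀ x : B, TangentSpace (𝓡 m) x),
      Horizon.IsHorizonCoordinate m v ∧
      (∀ p q, leaf p q ↔ v p = v q) ∧
      (∀ x, Horizon.SmoothAt (𝓡 m) Φ x) ∧
      (∀ p, Horizon.dirDeriv (Horizon.HModel m) v p (k p) = a ∧
        Horizon.baseComp p (k p) = b • Φ p.1) ∧
      ∀ (U : Set M) (n ζ : ∀ x : M, TangentSpace (𝓡 (m + 2)) x) (X : M → B) (V r : M → ℝ),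
        Horizon.IsBondiLike g j v U n ζ X V r →
        ∀ y ∈ U, Horizon.dirDeriv (𝓡 (m + 2)) V y (K y) = a ∧
          mfderiv (𝓡 (m + 2)) (𝓡 m) X y (K y) = b • Φ (X y) ∧
          Horizon.dirDeriv (𝓡 (m + 2)) r y (K y) = 0 := by
  have hjs := hj.embedding.contMDiff
  have hℓv : ∀ p, Horizon.baseComp p (ℓ p) = 0 := fun p =>
    Horizon.baseComp_eq_zero_of_null hj (hℓ_null p)
  obtain ⟨v, a, hv, hlv, ha⟩ := Horizon.exists_adapted_coordinate hleaf hk.1 hℓ_smooth hℓv hℓ_ne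
    hℓk hpres
  have hΦ : ∀ p : B × ℝ, Horizon.baseComp p (k p) = Horizon.baseComp (p.1, 0) (k (p.1, 0)) :=
    fun p => Horizon.baseComp_eq_of_commute hk.1 hℓ_smooth hℓv hℓ_ne hℓk p.1 p.2 0
  -- Since `Φ` is itself the projection of `k`, the constant `b` can be 1. The slice at height 0
  -- represents `Φ`, as the projection is constant along fibres.
  refine ⟨v, a, 1, fun x => Horizon.baseComp (x, 0) (k (x, 0)), hv, hlv,
    Horizon.smoothAt_baseComp hk.1 0, fun p => ⟨ha p, ?_⟩, ?_⟩
  · rw [one_smul]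
    exact hΦ p
  · intro U n ζ X V r hB y hy
    refine ⟨Horizon.vderiv_V_killing hjs hv hB hK hk ha hy, ?_,
      Horizon.vderiv_r_killing hjs hv hB hK hk ha hy⟩
    rw [one_smul]
    exact Horizon.mfderiv_X_killing hjs hv hB hK hk ha
      (Φ := fun x => Horizon.baseComp (x, 0) (k (x, 0))) hΦ hy
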